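/- Let $G$ be a countable group acting by homeomorphisms on a compact metrizable space $M$ as a convergence group: every sequence of distinct elements of $G$ has a subsequence $(g_{n_k})$ for which there are $a,b\in M$ such that $g_{n_k}|_{M\setminus\{a\}}$ converges to $b$ locally uniformly. Assume that the action is minimal and non-elementary (no invariant subset of $M$ consists of one or two points). An annulus is an ordered pair $A=(A^-,A^+)$ of disjoint closed subsets of $M$ with $A^-\cup A^+\ne M$; put $-A=(A^+,A^-)$ and $gA=(gA^-,gA^+)$. Fix an annulus $A$ for which there are $g\in G$ and distinct fixed points $a\in\operatorname{int}A^-$, $b\in\operatorname{int}A^+$ of $g$ such that $g^n|_{M\setminus\{a\}}$ converges to $b$ locally uniformly, and let $\mathcal A=\{h(\pm A): h\in G\}$. For $K,L\subset M$ let $(K|L)\in\{0,1,\dots,\infty\}$ be the maximal $n$ such that there are $A_1,\dots,A_n\in\mathcal A$ with $K\subset\operatorname{int}A_1^-$, $\operatorname{int}A_i^+\cup\operatorname{int}A_{i+1}^-=M$ for $1\le i<n$, and $L\subset\operatorname{int}A_n^+$. On the space $T$ of triples of pairwise distinct points of $M$ let $$\rho(x,y)=\max\{(\{x^i,x^j\}|\{y^k,y^l\})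 : i\ne j,\ k\ne l\}$$ (Sun's quasimetric). Let $\partial T$ be the Gromov boundary of $(T,\rho)$: with $(x\cdot y)_p=\frac12(\rho(p,x)+\rho(p,y)-\rho(x,y))$, it is the set of sequences $(x_n)\subset T$ with $(x_n\cdot x_m)_p\to\infty$ as $n,m\to\infty$, modulo the equivalence relation (generated by) $(x_n)\sim(y_n)$ iff $(x_n\cdot y_n)_p\to\infty$. Its topology is the one in which $U\subset\partial T$ is open iff for all $\xi\in U$ and $p \in T$ there is $R$ such that $\eta\in U$ whenever $(\eta\cdot\xi)_p\ge R$, where $(\eta\cdot\xi)_p=\sup\liminf_{m,n\to\infty}(x_m\cdot y_n)_p$ over all sequences $(x_m)$, $(y_n)$ representing $\eta$, $\xi$. The group $G$ acts on $\partial T$ by $g[(x_n)]=[(gx_n)]$. Say that $x_n\in T$ converges to $p\in M$ if it does so in the topology on $T\cup M$ generated by the open subsets of $T$ and the sets $\{x\in T: x \text{ has at least two components in } U\}\cup U$, $U\subset M$ open. Let $M_\infty$ be the set of infinite boundary points, i.e. of those $p\in M$ to which no sequence $(x_n)\subset T$ with $\rho(x_0,x_n)$ bounded (for a base point $x_0\in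 T$) converges. Then $\rho$ takes only finite values, and there is a $G$-equivariant continuous map $\varphi:\partial T\to M$ whose restriction to $\varphi^{-1}(M_\infty)$ is a homeomorphism from $\varphi^{-1}(M_\infty)$ onto $M_\infty$. -/

import Mathlib

open Set Filter Topology
open scoped Pointwise

/-! ### Gromov boundary of a set with a (quasi)metric -/

section GromovBoundarySection

variable {Q : Type*}

/-- The Gromov product `(x · y)_p`. -/
noncomputable def gromovProduct (ρ : Q → Q → ℝ) (p x y : Q) : ℝ :=
  (ρ p x + ρ p y - ρ x y) / 2

/-- Sequences with `(xₙ · xₘ)_p → ∞` as `n, m → ∞`, for every base point `p`. -/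
def IsGromovSequence (ρ : Q → Q → ℝ) (x : ℕ → Q) : Prop :=
  ∀ p : Q, Tendsto (fun nm : ℕ × ℕ => gromovProduct ρ p (x nm.1) (x nm.2))
    (atTop ×ˢ atTop) atTop

/-- The relation `(xₙ) ∼ (yₙ)` on Gromov sequences: `(xₙ · yₙ)_p → ∞` for every `p`. -/
def GromovRelated (ρ : Q → Q → ℝ) (x y : {x : ℕ → Q // IsGromovSequence ρ x}) : Prop :=
  ∀ p : Q, Tendsto (fun n : ℕ => gromovProduct ρ p (x.1 n) (y.1 n)) atTop atTop

/-- The Gromov boundary: Gromov sequences modulo the equivalence relation `∼`. (For a hyperbolic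
quasimetric `∼` is already transitive; `Quot` divides by the equivalence relation generated
by `∼`, so that the definition makes sense for every function `ρ`.) -/
def GromovBoundary (ρ : Q → Q → ℝ) : Type _ := Quot (GromovRelated ρ)

/-- The boundary point represented by a Gromov sequence. -/
def GromovBoundary.mk (ρ : Q → Q → ℝ) (x : {x : ℕ → Q // IsGromovSequence ρ x}) :
    GromovBoundary ρ := Quot.mk _ x

/-- The Gromov product of two boundary points, `sup liminf_{m,n → ∞} (xₘ · yₙ)_p`, the supremum
being taken over all sequences that represent the two points. -/
noncomputable def boundaryProduct (ρ : Q → Q → ℝ) (p : Q) (ξ η : GromovBoundary ρ) : EReal :=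
  ⨆ (x : {x : ℕ → Q // IsGromovSequence ρ x}) (_ : GromovBoundary.mk ρ x = ξ)
    (y : {y : ℕ → Q // IsGromovSequence ρ y}) (_ : GromovBoundary.mk ρ y = η),
    liminf (fun mn : ℕ × ℕ => ((gromovProduct ρ p (x.1 mn.1) (y.1 mn.2) : ℝ) : EReal))
      (atTop ×ˢ atTop)

/-- The topology of the Gromov boundary: `U` is open if it contains, with each of its points `ξ`,
all points `η` whose product with `ξ` is large. Equivalently, `U` is open iff
`(ηₙ · ξ)_p → ∞` with `ξ ∈ U` implies that `ηₙ ∈ U` for large `n`. -/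
instance GromovBoundary.instTopologicalSpace (ρ : Q → Q → ℝ) :
    TopologicalSpace (GromovBoundary ρ) where
  IsOpen U := ∀ ξ ∈ U, ∀ p : Q, ∃ R : ℝ, ∀ η, (R : EReal) ≤ boundaryProduct ρ p η ξ → η ∈ U
  isOpen_univ := fun _ _ _ => ⟨0, fun _ _ => trivial⟩
  isOpen_inter := by
    intro U V hU hV ξ hξ p
    obtain ⟨R, hR⟩ := hU ξ hξ.1 p
    obtain ⟨S, hS⟩ := hV ξ hξ.2 p
    refine ⟨max R S, fun η hη => ⟨hR η (le_trans ?_ hη), hS η (le_trans ?_ hη)⟩⟩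
    · exact EReal.coe_le_coe_iff.2 (le_max_left R S)
    · exact EReal.coe_le_coe_iff.2 (le_max_right R S)
  isOpen_sUnion := by
    rintro 𝒰 h𝒰 ξ ⟨U, hU, hξ⟩ p
    obtain ⟨R, hR⟩ := h𝒰 U hU ξ hξ p
    exact ⟨R, fun η hη => ⟨U, hU, hR η hη⟩⟩

end GromovBoundarySection

/-! ### Convergence groups -/

/-- `uₙ` restricted to `M ∖ {a}` converges to `b` locally uniformly. -/
def ConvergesOffPoint {G M : Type*} [Group G] [TopologicalSpace M] [MulAction G M]
    (u : ℕ → G) (a b : M) : Prop :=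
  ∀ K : Set M, IsCompact K → K ⊆ {a}ᶜ → ∀ U ∈ 𝓝 b, ∀ᶠ n in atTop, u n • K ⊆ U

/-- The convergence property of an action: every sequence of distinct elements has a subsequence
with a repelling point `a` and an attracting point `b`. -/
def IsConvergenceAction (G M : Type*) [Group G] [TopologicalSpace M] [MulAction G M] : Prop :=
  ∀ u : ℕ → G, Function.Injective u →
    ∃ k : ℕ → ℕ, StrictMono k ∧ ∃ a b : M, ConvergesOffPoint (u ∘ k) a b

/-- There is no invariant set consisting of one or two points. -/
def IsNonElementaryAction (G M : Type*) [Group G] [MulAction G M] : Prop :=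
  ∀ S : Set M, (∀ g : G, g • S = S) → S.encard ≠ 1 ∧ S.encard ≠ 2

/-! ### Distinct triples and the topology on triples together with `M` -/

/-- The space `T` of triples of pairwise distinct points of `M`. -/
def Triples (M : Type*) : Type _ := {x : Fin 3 → M // Function.Injective x}

instance Triples.instTopologicalSpace (M : Type*) [TopologicalSpace M] :
    TopologicalSpace (Triples M) :=
  inferInstanceAs (TopologicalSpace {x : Fin 3 → M // Function.Injective x})

/-- The diagonal action on triples. -/
instance Triples.instMulAction (G M : Type*) [Group G] [MulAction G M] :
    MulAction G (Triples M) where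
  smul g x := ⟨fun i => g • x.1 i, (MulAction.injective g).comp x.2⟩
  one_smul x := Subtype.ext (funext fun i => one_smul G (x.1 i))
  mul_smul g h x := Subtype.ext (funext fun i => mul_smul g h (x.1 i))

/-- For `U ⊆ M`, the union of `U` and of the set of triples with at least two components
in `U`. -/
def tukiaSet {M : Type*} (U : Set M) : Set (Triples M ⊕ M) :=
  Sum.inl '' {x : Triples M | ∃ i j : Fin 3, i ≠ j ∧ x.1 i ∈ U ∧ x.1 j ∈ U} ∪ Sum.inr '' U

/-- The topology on the disjoint union of `T` and `M` generated by the open sets of `T` and by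
the sets `tukiaSet U` with `U` open in `M`. -/
@[reducible]
def tukiaTopology (M : Type*) [TopologicalSpace M] : TopologicalSpace (Triples M ⊕ M) :=
  TopologicalSpace.generateFrom
    ({W | ∃ V : Set (Triples M), IsOpen V ∧ W = Sum.inl '' V} ∪
      {W | ∃ U : Set M, IsOpen U ∧ W = tukiaSet U})

/-- A sequence of triples converges to a point of `M` in the topology above. -/
def TukiaTendsto {M : Type*} [TopologicalSpace M] (x : ℕ → Triples M) (p : M) : Prop :=
  Tendsto (fun n => (Sum.inl (x n) : Triples M ⊕ M)) atTop (@nhds _ (tukiaTopology M) (Sum.inr p))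

/-! ### Annuli, the crossratio, and the quasimetric -/

/-- An annulus: an ordered pair of disjoint closed sets that do not cover `M`. -/
@[ext]
structure Annulus (M : Type*) [TopologicalSpace M] where
  neg : Set M
  pos : Set M
  isClosed_neg : IsClosed neg
  isClosed_pos : IsClosed pos
  disjoint : Disjoint neg pos
  nonempty_compl : ((neg ∪ pos)ᶜ).Nonempty

namespace Annulus

section Basic

variable {M : Type*} [TopologicalSpace M]

/-- The annulus `-A = (A⁺, A⁻)`. -/
def opp (A : Annulus M) : Annulus M where
  neg := A.pos
  pos := A.neg
  isClosed_neg := A.isClosed_pos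
  isClosed_pos := A.isClosed_neg
  disjoint := A.disjoint.symm
  nonempty_compl := by
    rw [union_comm]
    exact A.nonempty_compl

/-- The relation `K < A`. -/
def SetLt (K : Set M) (A : Annulus M) : Prop := K ⊆ interior A.neg

/-- The relation `A < K`. -/
def LtSet (A : Annulus M) (K : Set M) : Prop := K ⊆ interior A.pos

/-- The relation `A < B` between annuli. -/
def Lt (A B : Annulus M) : Prop := interior A.pos ∪ interior B.neg = univ

/-- `c 0, …, c (n - 1)` is a chain `K < c 0 < c 1 < ⋯ < c (n - 1) < L` of annuli of `𝒜`
(no condition if `n = 0`). -/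
structure IsChainBetween (𝒜 : Set (Annulus M)) (K L : Set M) (n : ℕ) (c : ℕ → Annulus M) :
    Prop where
  mem : ∀ i, i < n → c i ∈ 𝒜
  lt_succ : ∀ i, i + 1 < n → (c i).Lt (c (i + 1))
  first : 0 < n → SetLt K (c 0)
  last : 0 < n → (c (n - 1)).LtSet L

/-- `(K|L)`: the maximal length of a chain of annuli of `𝒜` between `K` and `L`, or `∞`. -/
noncomputable def separation (𝒜 : Set (Annulus M)) (K L : Set M) : ℕ∞ :=
  ⨆ (n : ℕ) (_ : ∃ c : ℕ → Annulus M, IsChainBetween 𝒜 K L n c), (n : ℕ∞)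

/-- `ρ(x, y) = max {(xⁱ, xʲ | yᵏ, yˡ) : i ≠ j, k ≠ l}`, with values in `[0, ∞]`. -/
noncomputable def tripleDist (𝒜 : Set (Annulus M)) (x y : Triples M) : ℕ∞ :=
  ⨆ (i : Fin 3) (j : Fin 3) (_ : i ≠ j) (k : Fin 3) (l : Fin 3) (_ : k ≠ l),
    separation 𝒜 {x.1 i, x.1 j} {y.1 k, y.1 l}

end Basic

section Action

variable {G M : Type*} [Group G] [TopologicalSpace M] [MulAction G M] [ContinuousConstSMul G M]

/-- The action `gA = (gA⁻, gA⁺)` on annuli. -/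
instance instMulAction : MulAction G (Annulus M) where
  smul g A :=
    { neg := g • A.neg
      pos := g • A.pos
      isClosed_neg := A.isClosed_neg.smul g
      isClosed_pos := A.isClosed_pos.smul g
      disjoint := disjoint_smul_set.2 A.disjoint
      nonempty_compl := by
        rw [← smul_set_union, ← smul_set_compl]
        exact A.nonempty_compl.smul_set }
  one_smul A := Annulus.ext (one_smul G A.neg) (one_smul G A.pos)
  mul_smul g h A := Annulus.ext (mul_smul g h A.neg) (mul_smul g h A.pos)

lemma smul_neg_set (g : G) (A : Annulus M) : (g • A).neg = g • A.neg := rfl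

lemma smul_pos_set (g : G) (A : Annulus M) : (g • A).pos = g • A.pos := rfl

/-- The annulus system `{g(±A) : g ∈ G}` generated by `A`. -/
def system (G : Type*) {M : Type*} [Group G] [TopologicalSpace M] [MulAction G M]
    [ContinuousConstSMul G M] (A : Annulus M) : Set (Annulus M) :=
  {B | ∃ g : G, B = g • A ∨ B = g • A.opp}

/-- The requirement on the generating annulus: there is `g ∈ G` fixing two distinct points
`a ∈ int A⁻`, `b ∈ int A⁺` such that `gⁿ` restricted to `M ∖ {a}` converges to `b` locally
uniformly. -/
def IsAdmissible (G : Type*) {M : Type*} [Group G] [TopologicalSpace M] [MulAction G M]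
    (A : Annulus M) : Prop :=
  ∃ (g : G) (a b : M), a ≠ b ∧ g • a = a ∧ g • b = b ∧
    ConvergesOffPoint (fun n : ℕ => g ^ n) a b ∧ a ∈ interior A.neg ∧ b ∈ interior A.pos

/-- The quasimetric on `T` of the annulus system generated by `A`, as a real-valued function. -/
noncomputable def rho (G : Type*) {M : Type*} [Group G] [TopologicalSpace M] [MulAction G M]
    [ContinuousConstSMul G M] (A : Annulus M) (x y : Triples M) : ℝ :=
  ((tripleDist (A.system G) x y).toNat : ℝ)

/-- Finite boundary points: limits in `M` of sequences of triples that stay at bounded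
distance from a base point. -/
def finiteBoundary (G : Type*) {M : Type*} [Group G] [TopologicalSpace M] [MulAction G M]
    [ContinuousConstSMul G M] (A : Annulus M) : Set M :=
  {p | ∃ (x : ℕ → Triples M) (x₀ : Triples M) (R : ℝ),
    TukiaTendsto x p ∧ ∀ n, A.rho G x₀ (x n) ≤ R}

/-- The set `M_∞` of infinite boundary points. -/
def infiniteBoundary (G : Type*) {M : Type*} [Group G] [TopologicalSpace M] [MulAction G M]
    [ContinuousConstSMul G M] (A : Annulus M) : Set M :=
  (A.finiteBoundary G)ᶜ

lemma smul_mem_system (g : G) {A B : Annulus M} (hB : B ∈ A.system G) : g • B ∈ A.system G := by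
  obtain ⟨h, rfl | rfl⟩ := hB
  · exact ⟨g * h, Or.inl (mul_smul g h A).symm⟩
  · exact ⟨g * h, Or.inr (mul_smul g h A.opp).symm⟩

lemma IsChainBetween.smul (g : G) {A : Annulus M} {K L : Set M} {n : ℕ} {c : ℕ → Annulus M}
    (hc : IsChainBetween (A.system G) K L n c) :
    IsChainBetween (A.system G) (g • K) (g • L) n (fun i => g • c i) where
  mem i hi := smul_mem_system g (hc.mem i hi)
  lt_succ i hi := by
    have h := hc.lt_succ i hi
    simp only [Lt, smul_neg_set, smul_pos_set, interior_smul] at h ⊢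
    rw [← smul_set_union, h, smul_set_univ]
  first hn := by
    have h := hc.first hn
    simp only [SetLt, smul_neg_set, interior_smul] at h ⊢
    exact smul_set_mono h
  last hn := by
    have h := hc.last hn
    simp only [LtSet, smul_pos_set, interior_smul] at h ⊢
    exact smul_set_mono h

lemma separation_smul (g : G) (A : Annulus M) (K L : Set M) :
    separation (A.system G) (g • K) (g • L) = separation (A.system G) K L := by
  have key : ∀ (h : G) (K' L' : Set M),
      separation (A.system G) K' L' ≤ separation (A.system G) (h • K') (h • L') := by
    intro h K' L'
    refine iSup₂_le fun n hn => ?_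
    obtain ⟨c, hc⟩ := hn
    exact le_iSup₂_of_le n ⟨_, hc.smul h⟩ le_rfl
  refine le_antisymm ?_ (key g K L)
  simpa only [inv_smul_smul] using key g⁻¹ (g • K) (g • L)

lemma rho_smul (g : G) (A : Annulus M) (x y : Triples M) :
    A.rho G (g • x) (g • y) = A.rho G x y := by
  have h : ∀ (z : Triples M) (i j : Fin 3),
      ({(g • z).1 i, (g • z).1 j} : Set M) = g • ({z.1 i, z.1 j} : Set M) := by
    intro z i j
    rw [smul_set_insert, smul_set_singleton]
    rfl
  simp only [rho, tripleDist, h, separation_smul]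

lemma gromovProduct_smul (g : G) (A : Annulus M) (p x y : Triples M) :
    gromovProduct (A.rho G) p (g • x) (g • y) = gromovProduct (A.rho G) (g⁻¹ • p) x y := by
  have h : ∀ z, A.rho G p (g • z) = A.rho G (g⁻¹ • p) z := by
    intro z
    rw [← rho_smul g A (g⁻¹ • p) z, smul_inv_smul]
  simp only [gromovProduct, h, rho_smul]

/-- The action `g[xₙ] = [g xₙ]` on the Gromov boundary of `(T, ρ)`. -/
instance instMulActionBoundary (A : Annulus M) : MulAction G (GromovBoundary (A.rho G)) where
  smul g := Quot.map
    (fun x => ⟨fun n => g • x.1 n, fun p => by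
      simpa only [gromovProduct_smul] using x.2 (g⁻¹ • p)⟩)
    (fun x y h p => by
      simpa only [gromovProduct_smul] using h (g⁻¹ • p))
  one_smul ξ := by
    obtain ⟨x, rfl⟩ := Quot.exists_rep ξ
    exact congrArg (Quot.mk _) (Subtype.ext (funext fun n => one_smul G (x.1 n)))
  mul_smul g h ξ := by
    obtain ⟨x, rfl⟩ := Quot.exists_rep ξ
    exact congrArg (Quot.mk _) (Subtype.ext (funext fun n => mul_smul g h (x.1 n)))

end Action

end Annulus

/-! Everything rests on two facts about the crossratio `(xy|zw)` of points. It is locally bounded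
where x ≠ y and z ≠ w: by the convergence property only finitely many translates of ±A separate
pairs near {x, y} from pairs near {z, w} (`finite_separating`, `eventually_separates_le`). It is
also hyperbolic up to a constant k: if one annulus separates {x, z} from {y, w}, chains between {x,
w} and {y, z} have length at most k (`exists_crossBound`), since that annulus can be translated to
±A and the rest is compactness. Hence chains can be concatenated with loss at most 3k + 4
(`CrossBound.concat`).

For the boundary this gives two estimates. Gromov products of triples near two distinct points of M
are bounded (`exists_gromovProduct_le`). Gromov products of triples near a common infinite boundary
point are large (`exists_nhds_le_gromovProduct`): otherwise one point of x, one point of y and a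
fixed third point would form a triple at bounded distance from p, but near that boundary point.

The first estimate, with compactness, makes every Gromov sequence converge to a unique point of M.
The limit depends only on the class of the sequence, and depends on it continuously and
equivariantly; this is φ. The second estimate gives injectivity and continuity of the inverse over
the infinite boundary points. It also shows that any sequence of triples tending to such a point is
a Gromov sequence. Such sequences exist because M has no isolated points (`neBot_nhdsNE`), whence
surjectivity. -/

namespace Annulus

/-! ### Combinatorics of chains of annuli. -/

section Chains

variable {M : Type*} [TopologicalSpace M] {𝒜 : Set (Annulus M)} {K L K' L' : Set M} {n m : ℕ}
  {c d : ℕ → Annulus M}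

/-- There is a chain of length `n` of annuli of `𝒜` between `K` and `L`. -/
def Separates (𝒜 : Set (Annulus M)) (K L : Set M) (n : ℕ) : Prop :=
  ∃ c : ℕ → Annulus M, IsChainBetween 𝒜 K L n c

lemma disjoint_interiors (A : Annulus M) : Disjoint (interior A.neg) (interior A.pos) :=
  A.disjoint.mono interior_subset interior_subset

lemma Lt.mem_neg {A B : Annulus M} (h : A.Lt B) {t : M} (ht : t ∉ interior A.pos) :
    t ∈ interior B.neg :=
  ((mem_union _ _ _).1 (h.symm ▸ mem_univ t : t ∈ interior A.pos ∪ interior B.neg)).resolve_left ht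

lemma Lt.interior_neg_subset {A B : Annulus M} (h : A.Lt B) : interior A.neg ⊆ interior B.neg :=
  fun _ ht => h.mem_neg (disjoint_left.1 A.disjoint_interiors ht)

lemma IsChainBetween.interior_neg_mono (hc : IsChainBetween 𝒜 K L n c) {i j : ℕ} (hij : i ≤ j)
    (hj : j < n) : interior (c i).neg ⊆ interior (c j).neg := by
  induction j, hij using Nat.le_induction with
  | base => exact subset_rfl
  | succ j _ ih => exact (ih (by omega)).trans (hc.lt_succ j hj).interior_neg_subset

lemma IsChainBetween.mem_neg_of_notMem_pos (hc : IsChainBetween 𝒜 K L n c) {i j : ℕ} (hij : i < j)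
    (hj : j < n) {t : M} (ht : t ∉ interior (c i).pos) : t ∈ interior (c j).neg :=
  hc.interior_neg_mono hij hj ((hc.lt_succ i (by omega)).mem_neg ht)

lemma IsChainBetween.mem_pos_of_notMem_neg (hc : IsChainBetween 𝒜 K L n c) {i j : ℕ} (hij : i < j)
    (hj : j < n) {t : M} (ht : t ∉ interior (c j).neg) : t ∈ interior (c i).pos :=
  by_contra fun h => ht (hc.mem_neg_of_notMem_pos hij hj h)

lemma IsChainBetween.subset_neg (hc : IsChainBetween 𝒜 K L n c) {i : ℕ} (hi : i < n) :
    K ⊆ interior (c i).neg :=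
  (hc.first (by omega)).trans (hc.interior_neg_mono (Nat.zero_le i) hi)

lemma IsChainBetween.subset_pos (hc : IsChainBetween 𝒜 K L n c) {i : ℕ} (hi : i < n) :
    L ⊆ interior (c i).pos := by
  intro t ht
  have h := hc.last (by omega) ht
  rcases Nat.lt_or_ge i (n - 1) with h' | h'
  · exact hc.mem_pos_of_notMem_neg h' (by omega) (disjoint_right.1 (c _).disjoint_interiors h)
  · rwa [show i = n - 1 by omega]

/-- The main tool for changing the separated sets: a consecutive piece of a chain is a chain between
whatever lies on the two sides of all its members. -/
lemma IsChainBetween.sub (hc : IsChainBetween 𝒜 K L n c) (s m : ℕ) (hsm : s + m ≤ n)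
    (hK : ∀ i, s ≤ i → i < s + m → K' ⊆ interior (c i).neg)
    (hL : ∀ i, s ≤ i → i < s + m → L' ⊆ interior (c i).pos) :
    IsChainBetween 𝒜 K' L' m (fun i => c (s + i)) where
  mem i hi := hc.mem _ (by omega)
  lt_succ i hi := hc.lt_succ (s + i) (by omega)
  first hm := hK _ (by omega) (by omega)
  last hm := hL _ (by omega) (by omega)

lemma IsChainBetween.append (hc : IsChainBetween 𝒜 K L n c) (hd : IsChainBetween 𝒜 K L m d)
    (h : 0 < n → 0 < m → (c (n - 1)).Lt (d 0)) :
    IsChainBetween 𝒜 K L (n + m) (fun i => if i < n then c i else d (i - n)) where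
  mem i hi := by
    split_ifs with h'
    · exact hc.mem i h'
    · exact hd.mem _ (by omega)
  lt_succ i hi := by
    rcases lt_trichotomy (i + 1) n with h' | h' | h'
    · rw [if_pos (by omega), if_pos h']
      exact hc.lt_succ i h'
    · rw [if_pos (by omega), if_neg (by omega)]
      have := h (by omega) (by omega)
      rwa [show i + 1 - n = 0 by omega, show i = n - 1 by omega]
    · rw [if_neg (by omega), if_neg (by omega), show i + 1 - n = i - n + 1 by omega]
      exact hd.lt_succ _ (by omega)
  first h0 := by
    split_ifs with h'
    · exact hc.first h'
    · exact hd.subset_neg (by omega)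
  last h0 := by
    split_ifs with h'
    · exact hc.subset_pos h'
    · exact hd.subset_pos (by omega)

lemma IsChainBetween.opp (h𝒜 : ∀ B ∈ 𝒜, B.opp ∈ 𝒜) (hc : IsChainBetween 𝒜 K L n c) :
    IsChainBetween 𝒜 L K n (fun i => (c (n - 1 - i)).opp) where
  mem i hi := h𝒜 _ (hc.mem _ (by omega))
  lt_succ i hi := by
    have h := hc.lt_succ (n - 1 - (i + 1)) (by omega)
    rw [show n - 1 - (i + 1) + 1 = n - 1 - i by omega] at h
    exact (union_comm _ _).trans h
  first hn := hc.subset_pos (i := n - 1 - 0) (by omega)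
  last hn := hc.subset_neg (i := n - 1 - (n - 1)) (by omega)

/-- A point outside both sides of one annulus lies on the negative side of all later ones. Thus the
length of a chain is at most the number of annuli available, which turns finiteness into bounds. -/
lemma IsChainBetween.injOn (hc : IsChainBetween 𝒜 K L n c) : InjOn c (Iio n) := by
  have key : ∀ i j, i < j → j < n → c i ≠ c j := by
    intro i j hij hj h
    obtain ⟨t, ht⟩ := (c i).nonempty_compl
    have h1 : t ∈ interior (c j).neg :=
      hc.mem_neg_of_notMem_pos hij hj fun h' => ht (Or.inr (interior_subset h'))
    rw [← h] at h1
    exact ht (Or.inl (interior_subset h1))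
  intro i hi j hj h
  rcases lt_trichotomy i j with h' | h' | h'
  · exact absurd h (key i j h' hj)
  · exact h'
  · exact absurd h.symm (key j i h' hi)

/-- The position of a point with respect to a chain. -/
lemma IsChainBetween.exists_position (hc : IsChainBetween 𝒜 K L n c) (t : M) :
    ∃ v ≤ n, (∀ i < v, t ∈ interior (c i).pos) ∧ ∀ i, v < i → i < n → t ∈ interior (c i).neg := by
  classical
  -- The position is the first index at which t leaves the positive side. At that index itself t may
  -- lie on neither side, which costs one annulus in every later estimate.
  have hex : ∃ i, n ≤ i ∨ t ∉ interior (c i).pos := ⟨n, Or.inl le_rfl⟩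
  refine ⟨Nat.find hex, Nat.find_le (Or.inl le_rfl), fun i hi => ?_, fun i hi hin => ?_⟩
  · by_contra h
    exact Nat.find_min hex hi (Or.inr h)
  · rcases Nat.find_spec hex with h | h
    · omega
    · exact hc.mem_neg_of_notMem_pos hi hin h

lemma exists_median (f : Fin 3 → ℕ) :
    ∃ v, (∃ a, f a = v) ∧ (∃ a b, a ≠ b ∧ v ≤ f a ∧ v ≤ f b) ∧
      ∃ a b, a ≠ b ∧ f a ≤ v ∧ f b ≤ v := by
  have h01 : (0 : Fin 3) ≠ 1 := by decide
  have h02 : (0 : Fin 3) ≠ 2 := by decide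
  have h12 : (1 : Fin 3) ≠ 2 := by decide
  rcases le_total (f 0) (f 1) with h | h <;> rcases le_total (f 1) (f 2) with h' | h' <;>
    rcases le_total (f 0) (f 2) with h'' | h''
  · exact ⟨f 1, ⟨1, rfl⟩, ⟨1, 2, h12, le_rfl, h'⟩, 0, 1, h01, h, le_rfl⟩
  · exact ⟨f 1, ⟨1, rfl⟩, ⟨1, 2, h12, le_rfl, h'⟩, 0, 1, h01, h, le_rfl⟩
  · exact ⟨f 2, ⟨2, rfl⟩, ⟨1, 2, h12, h', le_rfl⟩, 0, 2, h02, h'', le_rfl⟩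
  · exact ⟨f 0, ⟨0, rfl⟩, ⟨0, 1, h01, le_rfl, h⟩, 0, 2, h02, le_rfl, h''⟩
  · exact ⟨f 0, ⟨0, rfl⟩, ⟨0, 2, h02, le_rfl, h''⟩, 0, 1, h01, le_rfl, h⟩
  · exact ⟨f 2, ⟨2, rfl⟩, ⟨0, 2, h02, h'', le_rfl⟩, 1, 2, h12, h', le_rfl⟩
  · exact ⟨f 1, ⟨1, rfl⟩, ⟨0, 1, h01, h, le_rfl⟩, 1, 2, h12, le_rfl, h'⟩
  · exact ⟨f 1, ⟨1, rfl⟩, ⟨0, 1, h01, h, le_rfl⟩, 1, 2, h12, le_rfl, h'⟩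

/-- Two pairs in a set of three elements always meet. -/
lemma mem_pair_or {a b i j : Fin 3} (hab : a ≠ b) (hij : i ≠ j) :
    (i = a ∨ i = b) ∨ (j = a ∨ j = b) := by
  revert a b i j
  decide

/-- The position of the median of a triple with respect to a chain. -/
lemma IsChainBetween.exists_median_position (hc : IsChainBetween 𝒜 K L n c) (p : Fin 3 → M) :
    ∃ v ≤ n, (∃ a b, a ≠ b ∧ ∀ i < v, p a ∈ interior (c i).pos ∧ p b ∈ interior (c i).pos) ∧
      ∃ a b, a ≠ b ∧
        ∀ i, v < i → i < n → p a ∈ interior (c i).neg ∧ p b ∈ interior (c i).neg := by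
  choose f hfn hpos hneg using fun a => hc.exists_position (p a)
  obtain ⟨v, ⟨w, hw⟩, ⟨a, b, hab, ha, hb⟩, a', b', hab', ha', hb'⟩ := exists_median f
  exact ⟨v, hw ▸ hfn w, ⟨a, b, hab, fun i hi => ⟨hpos a i (by omega), hpos b i (by omega)⟩⟩,
    a', b', hab', fun i hi hin => ⟨hneg a' i (by omega) hin, hneg b' i (by omega) hin⟩⟩

lemma Separates.symm (h𝒜 : ∀ B ∈ 𝒜, B.opp ∈ 𝒜) (h : Separates 𝒜 K L n) :
    Separates 𝒜 L K n :=
  let ⟨_, hc⟩ := h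
  ⟨_, hc.opp h𝒜⟩

lemma Separates.of_le (h : Separates 𝒜 K L n) (hmn : m ≤ n) : Separates 𝒜 K L m :=
  let ⟨_, hc⟩ := h
  ⟨_, hc.sub 0 m (by omega) (fun _ _ _ => hc.subset_neg (by omega))
    fun _ _ _ => hc.subset_pos (by omega)⟩

lemma Separates.disjoint (h : Separates 𝒜 K L n) (hn : 0 < n) : Disjoint K L :=
  let ⟨c, hc⟩ := h
  (c 0).disjoint_interiors.mono (hc.subset_neg hn) (hc.subset_pos hn)

lemma le_separation (h : Separates 𝒜 K L n) : (n : ℕ∞) ≤ separation 𝒜 K L :=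
  le_iSup₂_of_le n h le_rfl

lemma separation_le {C : ℕ∞} (h : ∀ n, Separates 𝒜 K L n → (n : ℕ∞) ≤ C) :
    separation 𝒜 K L ≤ C :=
  iSup₂_le h

/-- Two crossing chains of annuli: if some annulus separates `x, z` from `y, w`, then the chains
between `x, w` and `y, z` have length at most `k`. -/
def CrossBound (𝒜 : Set (Annulus M)) (k : ℕ) : Prop :=
  ∀ x y z w : M, ∀ n, Separates 𝒜 {x, z} {y, w} 1 → Separates 𝒜 {x, w} {y, z} n → n ≤ k

/-- Chains of annuli can be concatenated up to a bounded error. -/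
lemma CrossBound.concat {k : ℕ} (hk : CrossBound 𝒜 k) {a b u x y : M} {l n : ℕ}
    (hl : 1 ≤ l) (hn : 1 ≤ n) (h1 : Separates 𝒜 {a, b} {u, x} l)
    (h2 : Separates 𝒜 {a, u} {x, y} n) :
    ∃ m, l + n ≤ m + (3 * k + 4) ∧ Separates 𝒜 {a, b} {x, y} m := by
  obtain ⟨B, hB⟩ := h1
  obtain ⟨A, hA⟩ := h2
  have hBn : ∀ i < l, a ∈ interior (B i).neg ∧ b ∈ interior (B i).neg := fun i hi => by
    simpa [pair_subset_iff] using hB.subset_neg hi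
  have hBp : ∀ i < l, u ∈ interior (B i).pos ∧ x ∈ interior (B i).pos := fun i hi => by
    simpa [pair_subset_iff] using hB.subset_pos hi
  have hAn : ∀ i < n, a ∈ interior (A i).neg ∧ u ∈ interior (A i).neg := fun i hi => by
    simpa [pair_subset_iff] using hA.subset_neg hi
  have hAp : ∀ i < n, x ∈ interior (A i).pos ∧ y ∈ interior (A i).pos := fun i hi => by
    simpa [pair_subset_iff] using hA.subset_pos hi
  obtain ⟨l', hl', hyp, hyn⟩ := hB.exists_position y
  obtain ⟨s, hs, hbp, hbn⟩ := hA.exists_position b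
  -- The members of `B` after the position of y separate {a, y} from {u, x}. They cross `A`, so
  -- there are at most k of them.
  have hl1 : l - (l' + 1) ≤ k := by
    rcases Nat.lt_or_ge l (l' + 1) with h | h
    · omega
    refine hk a x u y _ (Separates.of_le ⟨A, hA⟩ hn) ⟨_, hB.sub (l' + 1) (l - (l' + 1)) (by omega)
      (fun i h1 h2 => ?_) fun i h1 h2 => ?_⟩
    · exact pair_subset (hBn i (by omega)).1 (hyn i (by omega) (by omega))
    · exact pair_subset (hBp i (by omega)).2 (hBp i (by omega)).1
  -- Symmetrically, the members of `A` before the position of b separate {a, u} from {x, b} and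
  -- cross `B`.
  have hs1 : s ≤ k := by
    refine hk a x b u _ ?_ ⟨_, hA.sub 0 s (by omega) (fun i h1 h2 => ?_) fun i h1 h2 => ?_⟩
    · rw [pair_comm x u]
      exact Separates.of_le ⟨B, hB⟩ hl
    · exact pair_subset (hAn i (by omega)).1 (hAn i (by omega)).2
    · exact pair_subset (hAp i (by omega)).1 (hbp i (by omega))
  -- All of the first l' members would do; k + 1 of them are kept back to link the two chains below.
  have hC1 : IsChainBetween 𝒜 {a, b} {x, y} (l' - k - 1) (fun i => B (0 + i)) :=
    hB.sub 0 _ (by omega)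
      (fun i h1 h2 => pair_subset (hBn i (by omega)).1 (hBn i (by omega)).2)
      fun i h1 h2 => pair_subset (hBp i (by omega)).2 (hyp i (by omega))
  rcases Nat.lt_or_ge n (s + 2) with hns | hns
  · exact ⟨_, by omega, _, hC1⟩
  have hC2 : IsChainBetween 𝒜 {a, b} {x, y} (n - (s + 2) + 1) (fun i => A (s + 1 + i)) :=
    hA.sub (s + 1) _ (by omega)
      (fun i h1 h2 => pair_subset (hAn i (by omega)).1 (hbn i (by omega) (by omega)))
      fun i h1 h2 => pair_subset (hAp i (by omega)).1 (hAp i (by omega)).2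
  refine ⟨_, ?_, _, hC1.append (hC2.sub 1 (n - (s + 2)) (by omega)
    (fun i h1 h2 => hC2.subset_neg (by omega)) fun i h1 h2 => hC2.subset_pos (by omega)) ?_⟩
  · omega
  · intro h0 h0'
    -- A point t violating the link would lie on the positive side of `A (s + 1)` and on the
    -- negative side of the k + 1 reserved members of `B`. These would be k + 1 annuli between {a,
    -- t} and {x, u} crossing one between {a, u} and {x, t}.
    refine eq_univ_of_forall fun t => ?_
    by_contra ht
    rw [mem_union, not_or] at ht
    obtain ⟨ht1, ht2⟩ := ht
    have hsep : Separates 𝒜 {a, u} {x, t} 1 := by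
      refine ⟨_, hA.sub (s + 1) 1 (by omega) (fun i h1 h2 => ?_) fun i h1 h2 => ?_⟩
      · exact pair_subset (hAn i (by omega)).1 (hAn i (by omega)).2
      · exact pair_subset (hAp i (by omega)).1
          (hA.mem_pos_of_notMem_neg (by omega) (by omega) ht2)
    have hle := hk a x u t (l' - (l' - k - 1)) hsep ⟨_, hB.sub (l' - k - 1) _ (by omega)
      (fun i h1 h2 => ?_) fun i h1 h2 => ?_⟩
    · omega
    · exact pair_subset (hBn i (by omega)).1 (hB.mem_neg_of_notMem_pos (by omega) (by omega) ht1)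
    · exact pair_subset (hBp i (by omega)).2 (hBp i (by omega)).1

end Chains

end Annulus

/-! ### Convergence dynamics and bounds for the crossratio. -/

lemma ConvergesOffPoint.tendsto_smul {G M : Type*} [Group G] [TopologicalSpace M]
    [LocallyCompactSpace M] [T1Space M] [MulAction G M] {u : ℕ → G} {a b t : M}
    (h : ConvergesOffPoint u a b) (hta : t ≠ a) {x : ℕ → M} (hx : Tendsto x atTop (𝓝 t)) :
    Tendsto (fun n => u n • x n) atTop (𝓝 b) := by
  obtain ⟨K, hK, hKa, hKc⟩ := local_compact_nhds (isOpen_compl_singleton.mem_nhds hta)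
  intro U hU
  rw [mem_map]
  filter_upwards [h K hKc hKa U hU, hx.eventually_mem hK] with n h1 h2 using
    h1 (smul_mem_smul_set h2)

namespace Annulus

section System

variable {G M : Type*} [Group G] [TopologicalSpace M] [MulAction G M] [ContinuousConstSMul G M]

lemma opp_mem_system {A B : Annulus M} (hB : B ∈ A.system G) : B.opp ∈ A.system G := by
  obtain ⟨g, rfl | rfl⟩ := hB
  exacts [⟨g, Or.inr rfl⟩, ⟨g, Or.inl rfl⟩]

lemma Separates.smul (g : G) {A : Annulus M} {a b x y : M} {n : ℕ}
    (h : Separates (A.system G) {a, b} {x, y} n) :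
    Separates (A.system G) {g • a, g • b} {g • x, g • y} n := by
  obtain ⟨c, hc⟩ := h
  have := hc.smul g
  simp only [smul_set_insert, smul_set_singleton] at this
  exact ⟨_, this⟩

lemma rho_nonneg (A : Annulus M) (x y : Triples M) : 0 ≤ A.rho G x y := Nat.cast_nonneg _

end System

section Dynamics

variable {G M : Type*} [Group G] [TopologicalSpace M] [CompactSpace M]
  [TopologicalSpace.MetrizableSpace M] [MulAction G M]

/-- Locally, only finitely many translates of a pair of disjoint closed sets separate two points
from two points. -/
lemma finite_separating (hconv : IsConvergenceAction G M) {K L : Set M} (hK : IsClosed K)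
    (hL : IsClosed L) (hKL : Disjoint K L) {x y z w : M} (hxy : x ≠ y) (hzw : z ≠ w) :
    ∃ F : Set G, F.Finite ∧ ∀ᶠ q : (M × M) × (M × M) in 𝓝 ((x, y), (z, w)), ∀ g : G,
      q.1.1 ∈ g • K → q.1.2 ∈ g • K → q.2.1 ∈ g • L → q.2.2 ∈ g • L → g ∈ F := by
  obtain ⟨U, hU⟩ := (𝓝 (((x, y), (z, w)) : (M × M) × (M × M))).exists_antitone_basis
  let S : ℕ → Set G := fun n => {g | ∃ q ∈ U n,
    q.1.1 ∈ g • K ∧ q.1.2 ∈ g • K ∧ q.2.1 ∈ g • L ∧ q.2.2 ∈ g • L}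
  by_cases hfin : ∃ n, (S n).Finite
  · obtain ⟨n, hn⟩ := hfin
    refine ⟨S n, hn, ?_⟩
    filter_upwards [hU.mem n] with q hq g h1 h2 h3 h4 using ⟨q, hq, h1, h2, h3, h4⟩
  exfalso
  push Not at hfin
  -- If all `S n` are infinite, there are distinct group elements separating pairs that converge to
  -- the given ones. Their inverses carry these pairs into K and L.
  obtain ⟨f, hfS, hf⟩ := exists_seq_of_forall_finset_exists (fun p : ℕ × G => p.2 ∈ S p.1)
    (fun p p' => p.1 < p'.1 ∧ p.2 ≠ p'.2) (by
      classical
      intro s _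
      obtain ⟨g, hgS, hg⟩ := (hfin (s.sup Prod.fst + 1)).exists_notMem_finset (s.image Prod.snd)
      refine ⟨(s.sup Prod.fst + 1, g), hgS, fun p hp => ⟨?_, ?_⟩⟩
      · exact Nat.lt_succ_of_le (Finset.le_sup (f := Prod.fst) hp)
      · rintro rfl
        exact hg (Finset.mem_image_of_mem _ hp))
  have hmono : StrictMono fun n => (f n).1 := fun m n hmn => (hf m n hmn).1
  have hinj : Function.Injective fun n => ((f n).2)⁻¹ := by
    intro m n hmn
    have h' : (f m).2 = (f n).2 := inv_injective hmn
    rcases lt_trichotomy m n with h | h | h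
    · exact absurd h' (hf m n h).2
    · exact h
    · exact absurd h'.symm (hf n m h).2
  choose q hqU hq using hfS
  have hlim : Tendsto q atTop (𝓝 ((x, y), (z, w))) :=
    (hU.tendsto fun n => hU.antitone (hmono.id_le n) (hqU n))
  obtain ⟨k, hk, a, b, hab⟩ := hconv _ hinj
  have hlim' := hlim.comp hk.tendsto_atTop
  simp only [mem_smul_set_iff_inv_smul_mem] at hq
  -- At most one of x, y is the repelling point a. The images of the points near the other one lie
  -- in K and tend to b. The same holds for z, w and L, so b lies in both.
  have hbK : b ∈ K := by
    rcases ne_or_eq x a with h | rfl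
    · exact hK.mem_of_tendsto (hab.tendsto_smul h
        ((continuous_fst.comp continuous_fst).continuousAt.tendsto.comp hlim'))
        (Eventually.of_forall fun n => (hq (k n)).1)
    · exact hK.mem_of_tendsto (hab.tendsto_smul hxy.symm
        ((continuous_snd.comp continuous_fst).continuousAt.tendsto.comp hlim'))
        (Eventually.of_forall fun n => (hq (k n)).2.1)
  have hbL : b ∈ L := by
    rcases ne_or_eq z a with h | rfl
    · exact hL.mem_of_tendsto (hab.tendsto_smul h
        ((continuous_fst.comp continuous_snd).continuousAt.tendsto.comp hlim'))
        (Eventually.of_forall fun n => (hq (k n)).2.2.1)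
    · exact hL.mem_of_tendsto (hab.tendsto_smul hzw.symm
        ((continuous_snd.comp continuous_snd).continuousAt.tendsto.comp hlim'))
        (Eventually.of_forall fun n => (hq (k n)).2.2.2)
  exact disjoint_left.1 hKL hbK hbL

variable [ContinuousConstSMul G M]

/-- The crossratio is locally bounded. -/
lemma eventually_separates_le (hconv : IsConvergenceAction G M) (A : Annulus M) {x y z w : M}
    (hxy : x ≠ y) (hzw : z ≠ w) :
    ∃ C : ℕ, ∀ᶠ q : (M × M) × (M × M) in 𝓝 ((x, y), (z, w)), ∀ n,
      Separates (A.system G) {q.1.1, q.1.2} {q.2.1, q.2.2} n → n ≤ C := by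
  obtain ⟨F, hF, h1⟩ := finite_separating hconv A.isClosed_neg A.isClosed_pos A.disjoint hxy hzw
  obtain ⟨F', hF', h2⟩ :=
    finite_separating hconv A.isClosed_pos A.isClosed_neg A.disjoint.symm hxy hzw
  have hfin : ((fun g : G => g • A) '' F ∪ (fun g : G => g • A.opp) '' F').Finite :=
    (hF.image _).union (hF'.image _)
  refine ⟨((fun g : G => g • A) '' F ∪ (fun g : G => g • A.opp) '' F').ncard, ?_⟩
  filter_upwards [h1, h2] with q hq hq' n hn
  obtain ⟨c, hc⟩ := hn
  have hsub : c '' Iio n ⊆ (fun g : G => g • A) '' F ∪ (fun g : G => g • A.opp) '' F' := by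
    rintro _ ⟨i, hi, rfl⟩
    have hneg := (hc.subset_neg hi).trans interior_subset
    have hpos := (hc.subset_pos hi).trans interior_subset
    obtain ⟨g, hg | hg⟩ := hc.mem i hi <;> rw [pair_subset_iff, hg] at hneg hpos
    · exact Or.inl ⟨g, hq g hneg.1 hneg.2 hpos.1 hpos.2, hg.symm⟩
    · exact Or.inr ⟨g, hq' g hneg.1 hneg.2 hpos.1 hpos.2, hg.symm⟩
  have := ncard_le_ncard hsub hfin
  rwa [hc.injOn.ncard_image, ← Finset.coe_Iio, ncard_coe_finset, Nat.card_Iio] at this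

/-- Disjointness forces x ≠ w and y ≠ z, so the local bounds apply on the whole compact set of such
quadruples. -/
lemma exists_separates_le_of_disjoint (hconv : IsConvergenceAction G M) (A : Annulus M)
    {K L : Set M} (hK : IsClosed K) (hL : IsClosed L) (hKL : Disjoint K L) :
    ∃ C : ℕ, ∀ x ∈ K, ∀ z ∈ K, ∀ y ∈ L, ∀ w ∈ L, ∀ n,
      Separates (A.system G) {x, w} {y, z} n → n ≤ C := by
  have hcomp : IsCompact ((K ×ˢ L) ×ˢ (L ×ˢ K)) :=
    (hK.isCompact.prod hL.isCompact).prod (hL.isCompact.prod hK.isCompact)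
  obtain ⟨C, hC⟩ := hcomp.induction_on (p := fun s => ∃ C : ℕ, ∀ q ∈ s, ∀ n,
      Separates (A.system G) {q.1.1, q.1.2} {q.2.1, q.2.2} n → n ≤ C)
    ⟨0, by simp⟩ (fun s t hst ⟨C, hC⟩ => ⟨C, fun q hq => hC q (hst hq)⟩)
    (fun s t ⟨C, hC⟩ ⟨D, hD⟩ => ⟨max C D, fun q hq n hn => hq.elim
      (fun h => (hC q h n hn).trans (le_max_left _ _))
      fun h => (hD q h n hn).trans (le_max_right _ _)⟩)
    (by
      rintro ⟨⟨x, w⟩, y, z⟩ ⟨⟨hx, hw⟩, hy, hz⟩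
      obtain ⟨C, hC⟩ := eventually_separates_le hconv A (hKL.ne_of_mem hx hw)
        (hKL.ne_of_mem hz hy).symm
      exact ⟨_, mem_nhdsWithin_of_mem_nhds hC, C, fun q hq => hq⟩)
  exact ⟨C, fun x hx z hz y hy w hw => hC ((x, w), (y, z)) ⟨⟨hx, hw⟩, hy, hz⟩⟩

/-- Since `(·|·)` is invariant, the single separating annulus may be moved to ±A; then all four
points lie in the two fixed disjoint closed sets of A. -/
lemma exists_crossBound (hconv : IsConvergenceAction G M) (A : Annulus M) :
    ∃ k, CrossBound (A.system G) k := by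
  obtain ⟨C, hC⟩ :=
    exists_separates_le_of_disjoint hconv A A.isClosed_neg A.isClosed_pos A.disjoint
  obtain ⟨D, hD⟩ :=
    exists_separates_le_of_disjoint hconv A A.isClosed_pos A.isClosed_neg A.disjoint.symm
  refine ⟨max C D, ?_⟩
  rintro x y z w n ⟨c, hc⟩ hn
  have hneg := (hc.subset_neg one_pos).trans interior_subset
  have hpos := (hc.subset_pos one_pos).trans interior_subset
  obtain ⟨g, hg | hg⟩ := hc.mem 0 one_pos <;>
    simp only [pair_subset_iff, hg, smul_neg_set, smul_pos_set,
      mem_smul_set_iff_inv_smul_mem] at hneg hpos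
  · exact (hC _ hneg.1 _ hneg.2 _ hpos.1 _ hpos.2 n (hn.smul g⁻¹)).trans (le_max_left _ _)
  · exact (hD _ hneg.1 _ hneg.2 _ hpos.1 _ hpos.2 n (hn.smul g⁻¹)).trans (le_max_right _ _)

/-- Local boundedness of the crossratios of the points of a triple with pairs of points. -/
lemma eventually_triple_separates_le (hconv : IsConvergenceAction G M) (A : Annulus M)
    (p : Triples M) {t t' : M} (ht : t ≠ t') :
    ∃ C : ℕ, ∀ᶠ q : M × M in 𝓝 (t, t'), ∀ a b, a ≠ b → ∀ n,
      Separates (A.system G) {p.1 a, p.1 b} {q.1, q.2} n → n ≤ C := by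
  have h : ∀ a b, ∃ C : ℕ, ∀ᶠ q : M × M in 𝓝 (t, t'), a ≠ b → ∀ n,
      Separates (A.system G) {p.1 a, p.1 b} {q.1, q.2} n → n ≤ C := by
    intro a b
    rcases eq_or_ne a b with rfl | hab
    · exact ⟨0, Eventually.of_forall fun q h => absurd rfl h⟩
    obtain ⟨C, hC⟩ := eventually_separates_le hconv A (p.2.ne hab) ht
    rw [nhds_prod_eq] at hC
    exact ⟨C, (hC.curry.self_of_nhds).mono fun q hq _ => hq⟩
  choose C hC using h
  refine ⟨Finset.univ.sup fun a => Finset.univ.sup (C a), ?_⟩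
  filter_upwards [eventually_all.2 fun a => eventually_all.2 (hC a)] with q hq a b hab n hn
  exact (hq a b hab n hn).trans ((Finset.le_sup (Finset.mem_univ b)).trans
    (Finset.le_sup (f := fun a => Finset.univ.sup (C a)) (Finset.mem_univ a)))

end Dynamics

/-! ### Finiteness and basic inequalities of the quasimetric. -/

section Distance

variable {M : Type*} [TopologicalSpace M] {𝒜 : Set (Annulus M)}

lemma tripleDist_le {x y : Triples M} {C : ℕ∞} (h : ∀ i j k l, i ≠ j → k ≠ l → ∀ n,
    Separates 𝒜 {x.1 i, x.1 j} {y.1 k, y.1 l} n → (n : ℕ∞) ≤ C) : tripleDist 𝒜 x y ≤ C :=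
  iSup_le fun i => iSup_le fun j => iSup_le fun hij => iSup_le fun k => iSup_le fun l =>
    iSup_le fun hkl => separation_le (h i j k l hij hkl)

lemma le_tripleDist {x y : Triples M} {i j k l : Fin 3} (hij : i ≠ j) (hkl : k ≠ l) {n : ℕ}
    (h : Separates 𝒜 {x.1 i, x.1 j} {y.1 k, y.1 l} n) : (n : ℕ∞) ≤ tripleDist 𝒜 x y :=
  (le_separation h).trans <| le_iSup_of_le i <| le_iSup_of_le j <| le_iSup_of_le hij <|
    le_iSup_of_le k <| le_iSup_of_le l <| le_iSup_of_le hkl le_rfl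

variable {G : Type*} [Group G] [CompactSpace M] [TopologicalSpace.MetrizableSpace M]
  [MulAction G M] [ContinuousConstSMul G M]

theorem tripleDist_ne_top (hconv : IsConvergenceAction G M) (A : Annulus M) (x y : Triples M) :
    tripleDist (A.system G) x y ≠ ⊤ := by
  have h : ∀ k l, ∃ C : ℕ, k ≠ l → ∀ i j, i ≠ j → ∀ n,
      Separates (A.system G) {x.1 i, x.1 j} {y.1 k, y.1 l} n → n ≤ C := by
    intro k l
    rcases eq_or_ne k l with rfl | hkl
    · exact ⟨0, fun h => absurd rfl h⟩
    obtain ⟨C, hC⟩ := eventually_triple_separates_le hconv A x (y.2.ne hkl)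
    exact ⟨C, fun _ => hC.self_of_nhds⟩
  choose C hC using h
  refine ne_top_of_le_ne_top (ENat.natCast_ne_top (Finset.univ.sup fun k => Finset.univ.sup (C k)))
    (tripleDist_le fun i j k l hij hkl n hn => Nat.cast_le.2 ?_)
  exact (hC k l hkl i j hij n hn).trans ((Finset.le_sup (Finset.mem_univ l)).trans
    (Finset.le_sup (f := fun k => Finset.univ.sup (C k)) (Finset.mem_univ k)))

lemma le_rho (hconv : IsConvergenceAction G M) (A : Annulus M) {x y : Triples M}
    {i j k l : Fin 3} (hij : i ≠ j) (hkl : k ≠ l) {n : ℕ}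
    (h : Separates (A.system G) {x.1 i, x.1 j} {y.1 k, y.1 l} n) : (n : ℝ) ≤ A.rho G x y := by
  have h' := le_tripleDist hij hkl h
  rw [← ENat.natCast_toNat (tripleDist_ne_top hconv A x y)] at h'
  exact Nat.cast_le.2 (Nat.cast_le.1 h')

lemma exists_separates_rho (hconv : IsConvergenceAction G M) (A : Annulus M) (x y : Triples M) :
    ∃ i j k l, i ≠ j ∧ k ≠ l ∧ ∃ n : ℕ,
      Separates (A.system G) {x.1 i, x.1 j} {y.1 k, y.1 l} n ∧ A.rho G x y = n := by
  by_contra! hcon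
  set D := (tripleDist (A.system G) x y).toNat with hD
  have hle : ∀ i j k l, i ≠ j → k ≠ l → ∀ n,
      Separates (A.system G) {x.1 i, x.1 j} {y.1 k, y.1 l} n → n < D := by
    intro i j k l hij hkl n hn
    by_contra! h
    exact hcon i j k l hij hkl D (hn.of_le h) rfl
  -- The empty chain always exists, so the subtraction in `D - 1` is not truncated.
  have h0 : 0 < D := hle 0 1 0 1 (by decide) (by decide) 0
    ⟨fun _ => A, ⟨by omega, by omega, by omega, by omega⟩⟩
  have h1 : tripleDist (A.system G) x y ≤ ((D - 1 : ℕ) : ℕ∞) :=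
    tripleDist_le fun i j k l hij hkl n hn => Nat.cast_le.2 (by
      have := hle i j k l hij hkl n hn
      omega)
  rw [← ENat.natCast_toNat (tripleDist_ne_top hconv A x y), ← hD, Nat.cast_le] at h1
  omega

lemma rho_le (hconv : IsConvergenceAction G M) (A : Annulus M) {x y : Triples M} {C : ℝ}
    (h : ∀ i j k l, i ≠ j → k ≠ l → ∀ n,
      Separates (A.system G) {x.1 i, x.1 j} {y.1 k, y.1 l} n → (n : ℝ) ≤ C) :
    A.rho G x y ≤ C := by
  obtain ⟨i, j, k, l, hij, hkl, n, hn, hρ⟩ := exists_separates_rho hconv A x y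
  exact hρ ▸ h i j k l hij hkl n hn

lemma rho_symm (hconv : IsConvergenceAction G M) (A : Annulus M) (x y : Triples M) :
    A.rho G x y = A.rho G y x :=
  le_antisymm
    (rho_le hconv A fun _ _ _ _ hij hkl _ hn =>
      le_rho hconv A hkl hij (hn.symm fun _ => opp_mem_system))
    (rho_le hconv A fun _ _ _ _ hij hkl _ hn =>
      le_rho hconv A hkl hij (hn.symm fun _ => opp_mem_system))

/-- Two pairs of points of one triple share a point, which no annulus can separate from itself. -/
lemma rho_self (hconv : IsConvergenceAction G M) (A : Annulus M) (x : Triples M) :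
    A.rho G x x = 0 := by
  refine le_antisymm (rho_le hconv A fun i j k l hij hkl n hn => ?_) (rho_nonneg A x x)
  rcases Nat.eq_zero_or_pos n with rfl | h
  · simp
  exfalso
  have hd := hn.disjoint h
  rcases mem_pair_or hkl hij with (rfl | rfl) | (rfl | rfl) <;>
    simp at hd

/-- The location of the median of `p` on a longest chain between two triples. -/
lemma exists_rho_chain (hconv : IsConvergenceAction G M) (A : Annulus M) {x y : Triples M}
    {i j k l : Fin 3} (hij : i ≠ j) (hkl : k ≠ l) {n : ℕ}
    (h : Separates (A.system G) {x.1 i, x.1 j} {y.1 k, y.1 l} n) (p : Triples M) :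
    ∃ v : ℕ, (v : ℝ) ≤ A.rho G p x ∧ (n : ℝ) ≤ v + 1 + A.rho G p y ∧
      ∃ a b, a ≠ b ∧ Separates (A.system G) {p.1 a, y.1 k} {x.1 i, x.1 j} v ∧
        Separates (A.system G) {p.1 b, y.1 k} {x.1 i, x.1 j} v := by
  obtain ⟨c, hc⟩ := h
  -- Two points of p lie beyond the first v annuli, and two lie before those after index v. The
  -- annulus at index v is lost, whence the error 1.
  obtain ⟨v, hv, ⟨a, b, hab, hpos⟩, a', b', hab', hneg⟩ := hc.exists_median_position p.1
  have hy : ∀ i < n, y.1 k ∈ interior (c i).pos := fun i hi =>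
    hc.subset_pos hi (mem_insert _ _)
  refine ⟨v, ?_, ?_, a, b, hab, ?_, ?_⟩
  · rw [rho_symm hconv]
    exact le_rho hconv A hij hab ⟨_, hc.sub 0 v (by omega) (fun i _ _ => hc.subset_neg (by omega))
      fun i _ _ => pair_subset (hpos i (by omega)).1 (hpos i (by omega)).2⟩
  · have hle := le_rho hconv A hab' hkl (x := p) (y := y) (n := n - (v + 1))
      ⟨_, hc.sub (min (v + 1) n) (n - (v + 1)) (by omega)
      (fun i _ _ => pair_subset (hneg i (by omega) (by omega)).1 (hneg i (by omega) (by omega)).2)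
      fun i _ _ => hc.subset_pos (by omega)⟩
    have : n ≤ v + 1 + (n - (v + 1)) := by omega
    have : (n : ℝ) ≤ v + 1 + (n - (v + 1) : ℕ) := by exact_mod_cast this
    linarith
  · exact Separates.symm (fun _ => opp_mem_system) ⟨_, hc.sub 0 v (by omega)
      (fun i _ _ => hc.subset_neg (by omega))
      fun i _ _ => pair_subset (hpos i (by omega)).1 (hy i (by omega))⟩
  · exact Separates.symm (fun _ => opp_mem_system) ⟨_, hc.sub 0 v (by omega)
      (fun i _ _ => hc.subset_neg (by omega))
      fun i _ _ => pair_subset (hpos i (by omega)).2 (hy i (by omega))⟩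

lemma rho_triangle (hconv : IsConvergenceAction G M) (A : Annulus M) (x p y : Triples M) :
    A.rho G x y ≤ A.rho G p x + A.rho G p y + 1 :=
  rho_le hconv A fun i j k l hij hkl n hn => by
    obtain ⟨v, h1, h2, -⟩ := exists_rho_chain hconv A hij hkl hn p
    linarith

lemma gromovProduct_comm (hconv : IsConvergenceAction G M) (A : Annulus M) (p x y : Triples M) :
    gromovProduct (A.rho G) p x y = gromovProduct (A.rho G) p y x := by
  simp only [gromovProduct, rho_symm hconv A x y, add_comm]

lemma gromovProduct_self (hconv : IsConvergenceAction G M) (A : Annulus M) (p x : Triples M) :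
    gromovProduct (A.rho G) p x x = A.rho G p x := by
  simp only [gromovProduct, rho_self hconv]
  ring

lemma gromovProduct_le_rho (hconv : IsConvergenceAction G M) (A : Annulus M)
    (p x y : Triples M) : gromovProduct (A.rho G) p x y ≤ A.rho G p x + 1 := by
  have h := rho_triangle hconv A p x y
  rw [rho_symm hconv A x p] at h
  simp only [gromovProduct]
  linarith

end Distance
end Annulus

/-! ### Triples near a point of M. -/

/-- The triples with at least two components in `U`. -/
def Triples.near {M : Type*} (U : Set M) : Set (Triples M) :=
  {x | ∃ i j : Fin 3, i ≠ j ∧ x.1 i ∈ U ∧ x.1 j ∈ U}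

lemma Triples.near_mono {M : Type*} {U V : Set M} (h : U ⊆ V) : near U ⊆ near V :=
  fun _ ⟨i, j, hij, hi, hj⟩ => ⟨i, j, hij, h hi, h hj⟩

/-- Open sets of triples contain no point of M, so only the sets `tukiaSet U` matter for the
neighbourhoods of q. -/
lemma tukiaTendsto_iff {M : Type*} [TopologicalSpace M] {x : ℕ → Triples M} {q : M} :
    TukiaTendsto x q ↔ ∀ U ∈ 𝓝 q, ∀ᶠ n in atTop, x n ∈ Triples.near U := by
  have hmem : ∀ (z : Triples M) (U : Set M),
      (Sum.inl z : Triples M ⊕ M) ∈ tukiaSet U ↔ z ∈ Triples.near U := by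
    intro z U
    simp [tukiaSet, Triples.near]
  have hq : ∀ U : Set M, (Sum.inr q : Triples M ⊕ M) ∈ tukiaSet U ↔ q ∈ U := by
    intro U
    simp [tukiaSet]
  simp only [TukiaTendsto, TopologicalSpace.nhds_generateFrom, tendsto_iInf,
    tendsto_principal]
  constructor
  · intro h U hU
    obtain ⟨V, hVU, hV, hqV⟩ := mem_nhds_iff.1 hU
    filter_upwards [h (tukiaSet V) ⟨(hq V).2 hqV, Or.inr ⟨V, hV, rfl⟩⟩] with n hn
    exact Triples.near_mono hVU ((hmem _ _).1 hn)
  · rintro h W ⟨hW, ⟨V, -, rfl⟩ | ⟨U, hU, rfl⟩⟩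
    · simp at hW
    · filter_upwards [h U (hU.mem_nhds ((hq U).1 hW))] with n hn using (hmem _ _).2 hn

lemma IsNonElementaryAction.exists_ne_ne {G M : Type*} [Group G] [MulAction G M]
    (hne : IsNonElementaryAction G M) (q q' : M) : ∃ u : M, u ≠ q ∧ u ≠ q' := by
  by_contra! h
  have huniv : (univ : Set M) = {q, q'} := by
    ext u
    simpa [or_iff_not_imp_left] using h u
  obtain ⟨h1, h2⟩ := hne univ fun g => smul_set_univ
  rw [huniv] at h1 h2
  rcases eq_or_ne q q' with rfl | hqq
  · simp at h1
  · exact h2 (encard_pair hqq)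

namespace Annulus

lemma nonempty_triples {G M : Type*} [Group G] [TopologicalSpace M] [MulAction G M]
    (hne : IsNonElementaryAction G M) (A : Annulus M) : Nonempty (Triples M) := by
  obtain ⟨t, -⟩ := A.nonempty_compl
  obtain ⟨u, hu, -⟩ := hne.exists_ne_ne t t
  obtain ⟨w, hwt, hwu⟩ := hne.exists_ne_ne t u
  refine ⟨![t, u, w], ?_⟩
  intro i j h
  fin_cases i <;> fin_cases j <;> simp_all [eq_comm]

/-! ### The two estimates for Gromov products. -/

section Product

variable {G M : Type*} [Group G] [TopologicalSpace M] [TopologicalSpace.MetrizableSpace M]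
  [MulAction G M] [ContinuousConstSMul G M]

/-- Near an infinite boundary point, the distance from the base point is large. -/
lemma exists_nhds_lt_rho {A : Annulus M} {q : M} (hq : q ∈ A.infiniteBoundary G) (p : Triples M)
    (R : ℝ) : ∃ U ∈ 𝓝 q, ∀ x ∈ Triples.near U, R < A.rho G p x := by
  by_contra! hcon
  obtain ⟨U, hU⟩ := (𝓝 q).exists_antitone_basis
  choose x hx hxR using fun n => hcon (U n) (hU.mem n)
  refine hq ⟨x, p, R, tukiaTendsto_iff.2 fun V hV => ?_, hxR⟩
  obtain ⟨N, hN⟩ := hU.mem_iff.1 hV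
  filter_upwards [eventually_ge_atTop N] with n hn
  exact Triples.near_mono ((hU.antitone hn).trans hN) (hx n)

variable [CompactSpace M]

lemma exists_separates_rho_near (hconv : IsConvergenceAction G M) (A : Annulus M)
    {x y : Triples M} {U V : Set M} (hx : x ∈ Triples.near U) (hy : y ∈ Triples.near V) :
    ∃ i j k l, i ≠ j ∧ k ≠ l ∧ x.1 i ∈ U ∧ y.1 k ∈ V ∧ ∃ n : ℕ,
      Separates (A.system G) {x.1 i, x.1 j} {y.1 k, y.1 l} n ∧ A.rho G x y = n := by
  -- With two of three components in W, every pair of components has one in W; it can be listed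
  -- first.
  have key : ∀ {z : Triples M} {W : Set M}, z ∈ Triples.near W → ∀ i j, i ≠ j →
      ∃ i' j', i' ≠ j' ∧ z.1 i' ∈ W ∧ ({z.1 i', z.1 j'} : Set M) = {z.1 i, z.1 j} := by
    rintro z W ⟨a, b, hab, ha, hb⟩ i j hij
    rcases mem_pair_or hab hij with (rfl | rfl) | (rfl | rfl)
    · exact ⟨i, j, hij, ha, rfl⟩
    · exact ⟨i, j, hij, hb, rfl⟩
    · exact ⟨j, i, hij.symm, ha, pair_comm _ _⟩
    · exact ⟨j, i, hij.symm, hb, pair_comm _ _⟩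
  obtain ⟨i, j, k, l, hij, hkl, n, hn, hρ⟩ := exists_separates_rho hconv A x y
  obtain ⟨i', j', hij', hi', h1⟩ := key hx i j hij
  obtain ⟨k', l', hkl', hk', h2⟩ := key hy k l hkl
  exact ⟨i', j', k', l', hij', hkl', hi', hk', n, by rwa [h1, h2], hρ⟩

/-- A triple is close to `p` if all its pairs of points have small crossratio with pairs of
points of `p`. -/
lemma rho_triple_le (hconv : IsConvergenceAction G M) (A : Annulus M) {p : Triples M}
    {u v w : M} (huv : u ≠ v) (huw : u ≠ w) (hvw : v ≠ w) {C : ℝ}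
    (h1 : ∀ a b, a ≠ b → ∀ n, Separates (A.system G) {p.1 a, p.1 b} {u, v} n → (n : ℝ) ≤ C)
    (h2 : ∀ a b, a ≠ b → ∀ n, Separates (A.system G) {p.1 a, p.1 b} {u, w} n → (n : ℝ) ≤ C)
    (h3 : ∀ a b, a ≠ b → ∀ n, Separates (A.system G) {p.1 a, p.1 b} {v, w} n → (n : ℝ) ≤ C) :
    ∃ z : Triples M, z.1 = ![u, v, w] ∧ A.rho G p z ≤ C := by
  have hinj : Function.Injective ![u, v, w] := by
    intro i j h
    fin_cases i <;> fin_cases j <;> simp_all [eq_comm]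
  refine ⟨⟨_, hinj⟩, rfl, rho_le hconv A ?_⟩
  intro a b k l hab hkl n hn
  have h1' := h1 a b hab n
  have h2' := h2 a b hab n
  have h3' := h3 a b hab n
  fin_cases k <;> fin_cases l <;> simp_all [pair_comm]

/-- Near an infinite boundary point, Gromov products are large. -/
lemma exists_nhds_le_gromovProduct (hconv : IsConvergenceAction G M)
    (hne : IsNonElementaryAction G M) {A : Annulus M} {q : M} (hq : q ∈ A.infiniteBoundary G)
    (p : Triples M) (R : ℝ) : ∃ U ∈ 𝓝 q, ∀ x ∈ Triples.near U, ∀ y ∈ Triples.near U,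
      R ≤ gromovProduct (A.rho G) p x y := by
  obtain ⟨k, hk⟩ := exists_crossBound hconv A
  obtain ⟨s, hsq, -⟩ := hne.exists_ne_ne q q
  obtain ⟨C, hC⟩ := eventually_triple_separates_le hconv A p hsq.symm
  rw [nhds_prod_eq] at hC
  replace hC := (hC.curry.mono fun t ht => ht.self_of_nhds).and (isOpen_ne.mem_nhds hsq.symm)
  let D : ℝ := 2 * |R| + 1 + (3 * k + 4) + C
  obtain ⟨U, hU, hUD⟩ := exists_nhds_lt_rho hq p D
  refine ⟨_, inter_mem hU hC, fun x hx y hy => ?_⟩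
  by_contra! hlt
  have hpx := hUD x (Triples.near_mono inter_subset_left hx)
  obtain ⟨i, j, k', l, hij, hkl, ⟨hiU, hiC, his⟩, ⟨hkU, hkC, hks⟩, m, hm, hρ⟩ :=
    exists_separates_rho_near hconv A hx hy
  obtain ⟨v, hv1, hv2, a₀, b₀, hab₀, ha₀, hb₀⟩ := exists_rho_chain hconv A hij hkl hm p
  have hR := le_abs_self R
  have hR0 := abs_nonneg R
  have hC0 : (0 : ℝ) ≤ C := Nat.cast_nonneg C
  have hk0 : (0 : ℝ) ≤ k := Nat.cast_nonneg k
  simp only [gromovProduct, hρ] at hlt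
  -- A small Gromov product means that the longest chain from x to y passes close to p, so its part
  -- before p is almost as long as ρ(p, x).
  have hv3 : A.rho G p x - 2 * |R| - 1 < v := by linarith
  have hv0 : 1 ≤ v := by
    have : (0 : ℝ) < v := by
      simp only [D] at hpx
      linarith
    exact_mod_cast this
  have hm0 : 0 < m := by
    have h0 := rho_nonneg (G := G) A p y
    have : (0 : ℝ) < m := by
      simp only [D] at hpx
      linarith
    exact_mod_cast this
  have hxy : x.1 i ≠ y.1 k' :=
    (hm.disjoint hm0).ne_of_mem (mem_insert _ _) (mem_insert _ _)
  -- A long chain from p to {xⁱ, yᵏ} could be continued by the v annuli towards x, giving a chain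
  -- from p to x longer than ρ(p, x).
  have hcen : ∀ a b, a ≠ b → ∀ l : ℕ,
      Separates (A.system G) {p.1 a, p.1 b} {x.1 i, y.1 k'} l → (l : ℝ) ≤ D := by
    intro a b hab l hl
    rcases Nat.eq_zero_or_pos l with rfl | hl0
    · simp only [D]
      push_cast
      linarith
    have key : ∀ a b, a ≠ b → Separates (A.system G) {p.1 a, p.1 b} {x.1 i, y.1 k'} l →
        Separates (A.system G) {p.1 a, y.1 k'} {x.1 i, x.1 j} v → (l : ℝ) ≤ D := by
      intro a b hab h1 h2
      rw [pair_comm (x.1 i)] at h1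
      obtain ⟨m', hm', hsep⟩ := hk.concat hl0 hv0 h1 h2
      have h3 := le_rho hconv A hab hij hsep
      have h4 : (l : ℝ) + v ≤ m' + (3 * k + 4) := by exact_mod_cast hm'
      simp only [D]
      linarith
    rcases mem_pair_or hab₀ hab with (rfl | rfl) | (rfl | rfl)
    · exact key _ _ hab hl ha₀
    · exact key _ _ hab hl hb₀
    · exact key _ _ hab.symm (by rwa [pair_comm (p.1 _)]) ha₀
    · exact key _ _ hab.symm (by rwa [pair_comm (p.1 _)]) hb₀
  -- The triple (xⁱ, yᵏ, s) has two components near q, yet is within D of p; this contradicts the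
  -- choice of U.
  obtain ⟨z, hz, hzD⟩ := rho_triple_le hconv A (C := D) hxy his hks hcen
    (fun a b hab n hn => (Nat.cast_le.2 (hiC a b hab n hn)).trans (by simp only [D]; linarith))
    (fun a b hab n hn => (Nat.cast_le.2 (hkC a b hab n hn)).trans (by simp only [D]; linarith))
  refine (hUD z ⟨0, 1, by decide, ?_, ?_⟩).not_ge hzD
  · rw [hz]
    exact hiU
  · rw [hz]
    exact hkU

/-- Gromov products of triples near two distinct points of `M` are bounded. -/
lemma exists_gromovProduct_le (hconv : IsConvergenceAction G M)
    (hne : IsNonElementaryAction G M) (A : Annulus M) {q q' : M} (hqq' : q ≠ q')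
    (p : Triples M) : ∃ R : ℝ, ∃ U ∈ 𝓝 q, ∃ V ∈ 𝓝 q', ∀ x ∈ Triples.near U,
      ∀ y ∈ Triples.near V, gromovProduct (A.rho G) p x y ≤ R := by
  obtain ⟨k, hk⟩ := exists_crossBound hconv A
  obtain ⟨u, huq, huq'⟩ := hne.exists_ne_ne q q'
  obtain ⟨C₁, hC₁⟩ := eventually_triple_separates_le hconv A p hqq'
  obtain ⟨C₂, hC₂⟩ := eventually_triple_separates_le hconv A p huq.symm
  obtain ⟨C₃, hC₃⟩ := eventually_triple_separates_le hconv A p huq'.symm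
  rw [nhds_prod_eq] at hC₁ hC₂ hC₃
  replace hC₂ := hC₂.curry.mono fun t ht => ht.self_of_nhds
  replace hC₃ := hC₃.curry.mono fun t ht => ht.self_of_nhds
  obtain ⟨U, hU, V, hV, hUV⟩ := mem_prod_iff.1 hC₁
  let C := max C₁ (max C₂ C₃)
  refine ⟨C + 2 + (3 * k + 4), _, inter_mem hU hC₂, _, inter_mem hV hC₃, fun x hx y hy => ?_⟩
  obtain ⟨a, b, i, j, hab, hij, -, ⟨hi, hi₂⟩, m, hm, hρx⟩ :=
    exists_separates_rho_near hconv A (x := p) (U := univ) ⟨0, 1, by decide, trivial, trivial⟩ hx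
  obtain ⟨a', b', k', l, hab', hkl, -, ⟨hk', hk'₃⟩, m', hm', hρy⟩ :=
    exists_separates_rho_near hconv A (x := p) (U := univ) ⟨0, 1, by decide, trivial, trivial⟩ hy
  have hk0 : (0 : ℝ) ≤ k := Nat.cast_nonneg k
  /- A chain from `p` to a pair near one of the points is passed early by two other points. -/
  have key : ∀ {a b : Fin 3} {z z' s t : M} {m : ℕ}, a ≠ b →
      Separates (A.system G) {p.1 a, p.1 b} {z, z'} m →
      (∀ a b, a ≠ b → ∀ n, Separates (A.system G) {p.1 a, p.1 b} {z, s} n → n ≤ C) →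
      (∀ a b, a ≠ b → ∀ n, Separates (A.system G) {p.1 a, p.1 b} {z, t} n → n ≤ C) →
      Separates (A.system G) {z, z'} {s, t} (m - (C + 1)) := by
    rintro a b z z' s t m hab ⟨c, hc⟩ hs ht
    have hz : ∀ i < m, z ∈ interior (c i).pos := fun i hi => hc.subset_pos hi (mem_insert _ _)
    have hpos : ∀ s, (∀ a b, a ≠ b → ∀ n,
        Separates (A.system G) {p.1 a, p.1 b} {z, s} n → n ≤ C) →
        ∀ i, C + 1 ≤ i → i < m → s ∈ interior (c i).neg := by
      intro s hs i hi him
      obtain ⟨v, hvm, hv, hv'⟩ := hc.exists_position s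
      have := hs a b hab v ⟨_, hc.sub 0 v (by omega) (fun i _ _ => hc.subset_neg (by omega))
        fun i _ _ => pair_subset (hz i (by omega)) (hv i (by omega))⟩
      exact hv' i (by omega) him
    exact Separates.symm (fun _ => opp_mem_system)
      ⟨_, hc.sub (min (C + 1) m) (m - (C + 1)) (by omega)
        (fun i h1 h2 => pair_subset (hpos s hs i (by omega) (by omega))
          (hpos t ht i (by omega) (by omega))) fun i h1 h2 => hc.subset_pos (by omega)⟩
  have hle₁ : C₁ ≤ C := le_max_left _ _
  have hle₂ : C₂ ≤ C := (le_max_left _ _).trans (le_max_right _ _)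
  have hle₃ : C₃ ≤ C := (le_max_right _ _).trans (le_max_right _ _)
  have hcross := hUV (mk_mem_prod hi hk')
  have h1 := key (s := u) (t := y.1 k') hab hm
    (fun a b hab n hn => (hi₂ a b hab n hn).trans hle₂)
    fun a b hab n hn => (hcross a b hab n hn).trans hle₁
  have h2 := (key (s := x.1 i) (t := u) hab' hm'
    (fun a b hab n hn => (hcross a b hab n (by rwa [pair_comm (x.1 i)])).trans hle₁)
    fun a b hab n hn => (hk'₃ a b hab n hn).trans hle₃).symm fun _ => opp_mem_system
  -- Concatenation needs both chains nonempty after removing C + 1 annuli. If one is too short, its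
  -- distance from p already bounds the product.
  rcases Nat.lt_or_ge m (C + 2) with hmC | hmC
  · have h3 := gromovProduct_le_rho hconv A p x y
    have h4 : (m : ℝ) + 1 ≤ C + 2 := by exact_mod_cast hmC
    rw [hρx] at h3
    linarith
  rcases Nat.lt_or_ge m' (C + 2) with hmC' | hmC'
  · have h3 := gromovProduct_le_rho hconv A p y x
    have h4 : (m' : ℝ) + 1 ≤ C + 2 := by exact_mod_cast hmC'
    rw [hρy, gromovProduct_comm hconv] at h3
    linarith
  -- The chains from x to p and from p to y, cut near p, join to a chain from x to y through the
  -- common point u. Thus ρ(x, y) is almost ρ(p, x) + ρ(p, y).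
  obtain ⟨r, hr, hsep⟩ := hk.concat (by omega) (by omega) h1 h2
  have h3 := le_rho hconv A hij hkl hsep
  have h4 : m + m' ≤ r + (3 * k + 4) + 2 * (C + 1) := by omega
  have h5 : (m : ℝ) + m' ≤ r + (3 * k + 4) + 2 * (C + 1) := by exact_mod_cast h4
  simp only [gromovProduct, hρx, hρy]
  linarith

end Product

end Annulus

lemma IsGromovSequence.tendsto_gromovProduct_self {Q : Type*} {ρ : Q → Q → ℝ} {x : ℕ → Q}
    (hx : IsGromovSequence ρ x) (p : Q) :
    Tendsto (fun n => gromovProduct ρ p (x n) (x n)) atTop atTop :=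
  (hx p).comp (tendsto_id.prodMk tendsto_id)

lemma exists_lt_gromovProduct_of_lt_boundaryProduct {Q : Type*} {ρ : Q → Q → ℝ} {p : Q}
    {ξ η : GromovBoundary ρ} {R : ℝ} (h : (R : EReal) < boundaryProduct ρ p η ξ) :
    ∃ y, GromovBoundary.mk ρ y = η ∧ ∃ x, GromovBoundary.mk ρ x = ξ ∧
      ∀ᶠ mn : ℕ × ℕ in atTop ×ˢ atTop, R < gromovProduct ρ p (y.1 mn.1) (x.1 mn.2) := by
  simp only [boundaryProduct, lt_iSup_iff] at h
  obtain ⟨y, hy, x, hx, h⟩ := h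
  exact ⟨y, hy, x, hx, (eventually_lt_of_lt_liminf h).mono fun _ h' => EReal.coe_lt_coe_iff.1 h'⟩

lemma TukiaTendsto.smul {G M : Type*} [Group G] [TopologicalSpace M] [MulAction G M]
    [ContinuousConstSMul G M] {x : ℕ → Triples M} {q : M} (h : TukiaTendsto x q) (g : G) :
    TukiaTendsto (fun n => g • x n) (g • q) := by
  rw [tukiaTendsto_iff] at h ⊢
  exact fun U hU => h _ ((continuous_const_smul g).continuousAt hU)

/-! ### Absence of isolated points. -/

namespace Annulus

/-- The repelling and attracting fixed points force the space to be perfect. -/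
lemma neBot_nhdsNE {G M : Type*} [Group G] [TopologicalSpace M] [CompactSpace M]
    [TopologicalSpace.MetrizableSpace M] [MulAction G M] [ContinuousConstSMul G M]
    (hne : IsNonElementaryAction G M) (hmin : MulAction.IsMinimal G M) {A : Annulus M}
    (hA : A.IsAdmissible G) (q : M) : (𝓝[≠] q).NeBot := by
  obtain ⟨g, a, b, hab, hga, hgb, hg, -, -⟩ := hA
  obtain ⟨c, hca, hcb⟩ := hne.exists_ne_ne a b
  by_contra hq
  have hopen : IsOpen ({q} : Set M) := by
    rwa [isOpen_singleton_iff_punctured_nhds, ← not_neBot]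
  -- By density the orbit of b meets the isolated point, so b is isolated too. Then gⁿc = b for some
  -- n and a third point c, although gⁿ is injective and fixes b.
  obtain ⟨_, hk, k, rfl⟩ := (hmin.dense_orbit b).inter_open_nonempty _ hopen ⟨q, rfl⟩
  have hkb : k • b = q := hk
  have hopen' : IsOpen ({b} : Set M) := by
    have := hopen.smul k⁻¹
    rwa [smul_set_singleton, ← hkb, inv_smul_smul] at this
  have hlim := hg.tendsto_smul hca (tendsto_const_nhds (x := c))
  obtain ⟨n, hn⟩ := (hlim.eventually_mem (hopen'.mem_nhds rfl)).exists
  have hfix : g ^ n • b = b := (MulAction.stabilizer G b).pow_mem hgb n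
  exact hcb (MulAction.injective (g ^ n) (hn.trans hfix.symm))

lemma exists_tukiaTendsto_of_neBot {G M : Type*} [Group G] [TopologicalSpace M]
    [TopologicalSpace.MetrizableSpace M] [MulAction G M] (hne : IsNonElementaryAction G M) {q : M}
    (hq : (𝓝[≠] q).NeBot) : ∃ x : ℕ → Triples M, TukiaTendsto x q := by
  obtain ⟨U, hU⟩ := (𝓝 q).exists_antitone_basis
  have hnon : ∀ n, (Triples.near (U n)).Nonempty := by
    intro n
    obtain ⟨t, htU, htq⟩ := (hq.nonempty_of_mem (inter_mem_nhdsWithin {q}ᶜ (hU.mem n))).imp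
      fun t ht => And.intro ht.2 ht.1
    obtain ⟨u, huq, hut⟩ := hne.exists_ne_ne q t
    have hinj : Function.Injective ![q, t, u] := by
      intro i j h
      fin_cases i <;> fin_cases j <;> simp_all [eq_comm]
    exact ⟨⟨_, hinj⟩, 0, 1, by decide, mem_of_mem_nhds (hU.mem n), htU⟩
  choose x hx using hnon
  refine ⟨x, tukiaTendsto_iff.2 fun V hV => ?_⟩
  obtain ⟨N, hN⟩ := hU.mem_iff.1 hV
  filter_upwards [eventually_ge_atTop N] with n hn
  exact Triples.near_mono ((hU.antitone hn).trans hN) (hx n)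

/-! ### The limit map on the Gromov boundary. -/

section Boundary

variable {G M : Type*} [Group G] [TopologicalSpace M] [CompactSpace M]
  [TopologicalSpace.MetrizableSpace M] [MulAction G M] [ContinuousConstSMul G M]

/-- Triples that leave all bounded sets accumulate at points of `M`. -/
lemma exists_forall_near_mem (hconv : IsConvergenceAction G M) (A : Annulus M) (p : Triples M)
    (f : Ultrafilter (Triples M)) (hf : Tendsto (A.rho G p) f atTop) :
    ∃ q : M, ∀ U ∈ 𝓝 q, Triples.near U ∈ f := by
  have hlim : ∀ k, ∃ t : M, Tendsto (fun x : Triples M => x.1 k) f (𝓝 t) := fun k =>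
    (isCompact_univ.ultrafilter_le_nhds (f.map fun x : Triples M => x.1 k) (by simp)).imp
      fun _ h => h.2
  choose t ht using hlim
  -- If the three component limits were distinct, local boundedness of the crossratio would bound
  -- ρ(p, ·) along f. So two limits coincide, and their common value is q.
  by_cases hinj : Function.Injective t
  · exfalso
    have hC : ∀ k l, ∃ C : ℕ, ∀ᶠ x : Triples M in f, k ≠ l → ∀ a b, a ≠ b → ∀ n,
        Separates (A.system G) {p.1 a, p.1 b} {x.1 k, x.1 l} n → n ≤ C := by
      intro k l
      rcases eq_or_ne k l with rfl | hkl
      · exact ⟨0, Eventually.of_forall fun x h => absurd rfl h⟩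
      obtain ⟨C, hC⟩ := eventually_triple_separates_le hconv A p (hinj.ne hkl)
      exact ⟨C, (((ht k).prodMk_nhds (ht l)).eventually hC).mono fun x hx _ => hx⟩
    choose C hC using hC
    have hC' := eventually_all.2 fun k => eventually_all.2 fun l => hC k l
    obtain ⟨x, hx, hlt⟩ := (hC'.and (hf.eventually_gt_atTop
      ((Finset.univ.sup fun k => Finset.univ.sup (C k) : ℕ) : ℝ))).exists
    refine hlt.not_ge (rho_le hconv A fun a b k l hab hkl n hn => Nat.cast_le.2 ?_)
    exact (hx k l hkl a b hab n hn).trans ((Finset.le_sup (Finset.mem_univ l)).trans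
      (Finset.le_sup (f := fun k => Finset.univ.sup (C k)) (Finset.mem_univ k)))
  · simp only [Function.Injective, not_forall] at hinj
    obtain ⟨k, l, hkl, hne⟩ := hinj
    refine ⟨t k, fun U hU => ?_⟩
    filter_upwards [ht k hU, ht l (hkl ▸ hU)] with x h1 h2 using ⟨k, l, hne, h1, h2⟩

/-- Gromov sequences converge to points of `M`. -/
lemma exists_tukiaTendsto (hconv : IsConvergenceAction G M) (hne : IsNonElementaryAction G M)
    (A : Annulus M) {x : ℕ → Triples M} (hx : IsGromovSequence (A.rho G) x) :
    ∃ q : M, TukiaTendsto x q := by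
  obtain ⟨p⟩ := nonempty_triples hne A
  have hρ : Tendsto (fun n => A.rho G p (x n)) atTop atTop := by
    simpa only [gromovProduct_self hconv] using hx.tendsto_gromovProduct_self p
  have hacc : ∀ f : Ultrafilter ℕ, (f : Filter ℕ) ≤ atTop →
      ∃ q : M, ∀ U ∈ 𝓝 q, ∀ᶠ n in (f : Filter ℕ), x n ∈ Triples.near U := fun f hf =>
    exists_forall_near_mem hconv A p (f.map x) (tendsto_map'_iff.2 (hρ.mono_left hf))
  obtain ⟨q, hq⟩ := hacc (Ultrafilter.of atTop) (Ultrafilter.of_le _)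
  refine ⟨q, tukiaTendsto_iff.2 fun U hU => ?_⟩
  by_contra hnot
  -- An ultrafilter on the indices with `x n` away from q yields a second accumulation point q'.
  -- Products of terms near q with terms near q' are bounded, against the double limit in
  -- `IsGromovSequence`.
  have hbot : (atTop ⊓ 𝓟 {n | x n ∉ Triples.near U}).NeBot :=
    frequently_mem_iff_neBot.1 (not_eventually.1 hnot)
  obtain ⟨q', hq'⟩ := hacc (Ultrafilter.of (atTop ⊓ 𝓟 {n | x n ∉ Triples.near U}))
    ((Ultrafilter.of_le _).trans inf_le_left)
  have hqq' : q ≠ q' := by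
    rintro rfl
    have hU' : ∀ᶠ n in (Ultrafilter.of (atTop ⊓ 𝓟 {n | x n ∉ Triples.near U}) : Filter ℕ),
        x n ∉ Triples.near U :=
      Ultrafilter.of_le _ (mem_inf_of_right (mem_principal_self _))
    obtain ⟨n, h1, h2⟩ := (hU'.and (hq' U hU)).exists
    exact h1 h2
  obtain ⟨R, U', hU', V, hV, hR⟩ := exists_gromovProduct_le hconv hne A hqq' p
  obtain ⟨mn, ⟨h1, h2⟩, h3⟩ := (((hq U' hU').prod_mk (hq' V hV)).and
    (((hx p).mono_left (prod_mono (Ultrafilter.of_le _)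
      ((Ultrafilter.of_le _).trans inf_le_left))).eventually_gt_atTop R)).exists
  exact h3.not_ge (hR _ h1 _ h2)

lemma eq_of_tendsto_gromovProduct (hconv : IsConvergenceAction G M)
    (hne : IsNonElementaryAction G M) {A : Annulus M} {p : Triples M} {x y : ℕ → Triples M}
    {q q' : M} (hx : TukiaTendsto x q) (hy : TukiaTendsto y q')
    (h : Tendsto (fun n => gromovProduct (A.rho G) p (x n) (y n)) atTop atTop) : q = q' := by
  by_contra hqq'
  obtain ⟨R, U, hU, V, hV, hR⟩ := exists_gromovProduct_le hconv hne A hqq' p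
  obtain ⟨n, hxn, hyn, hn⟩ := ((tukiaTendsto_iff.1 hx U hU).and
    ((tukiaTendsto_iff.1 hy V hV).and (h.eventually_gt_atTop R))).exists
  exact hn.not_ge (hR _ hxn _ hyn)

/-- The limit map from the Gromov boundary to `M`. -/
lemma exists_limitMap (hconv : IsConvergenceAction G M) (hne : IsNonElementaryAction G M)
    (A : Annulus M) : ∃ φ : GromovBoundary (A.rho G) → M,
      ∀ x, TukiaTendsto x.1 (φ (GromovBoundary.mk _ x)) := by
  choose f hf using fun x : {x : ℕ → Triples M // IsGromovSequence (A.rho G) x} =>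
    exists_tukiaTendsto hconv hne A x.2
  obtain ⟨p⟩ := nonempty_triples hne A
  exact ⟨Quot.lift f fun x y h => eq_of_tendsto_gromovProduct hconv hne (hf x) (hf y) (h p), hf⟩

variable {A : Annulus M} {φ : GromovBoundary (A.rho G) → M}

lemma limitMap_eq (hconv : IsConvergenceAction G M) (hne : IsNonElementaryAction G M)
    (hφ : ∀ x, TukiaTendsto x.1 (φ (GromovBoundary.mk _ x)))
    (x : {x : ℕ → Triples M // IsGromovSequence (A.rho G) x}) {q : M}
    (hq : TukiaTendsto x.1 q) : φ (GromovBoundary.mk _ x) = q := by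
  obtain ⟨p⟩ := nonempty_triples hne A
  exact eq_of_tendsto_gromovProduct hconv hne (hφ x) hq (x.2.tendsto_gromovProduct_self p)

lemma limitMap_smul (hconv : IsConvergenceAction G M) (hne : IsNonElementaryAction G M)
    (hφ : ∀ x, TukiaTendsto x.1 (φ (GromovBoundary.mk _ x))) (g : G)
    (ξ : GromovBoundary (A.rho G)) : φ (g • ξ) = g • φ ξ := by
  obtain ⟨x, rfl⟩ := Quot.exists_rep ξ
  exact limitMap_eq hconv hne hφ ⟨fun n => g • x.1 n, _⟩ ((hφ x).smul g)

lemma continuous_limitMap (hconv : IsConvergenceAction G M) (hne : IsNonElementaryAction G M)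
    (hφ : ∀ x, TukiaTendsto x.1 (φ (GromovBoundary.mk _ x))) : Continuous φ := by
  refine continuous_def.2 fun W hW ξ hξ p => ?_
  -- Compactness of the complement of W makes R and U independent of q.
  have hbound : ∃ R : ℝ, ∃ U ∈ 𝓝 (φ ξ), ∀ q ∈ Wᶜ, ∃ V ∈ 𝓝 q, ∀ x ∈ Triples.near U,
      ∀ y ∈ Triples.near V, gromovProduct (A.rho G) p x y ≤ R := by
    refine hW.isClosed_compl.isCompact.induction_on (p := fun s => ∃ R : ℝ, ∃ U ∈ 𝓝 (φ ξ),
      ∀ q ∈ s, ∃ V ∈ 𝓝 q, ∀ x ∈ Triples.near U,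
        ∀ y ∈ Triples.near V, gromovProduct (A.rho G) p x y ≤ R)
      ⟨0, univ, univ_mem, by simp⟩
      (fun s t hst ⟨R, U, hU, h⟩ => ⟨R, U, hU, fun q hq => h q (hst hq)⟩) ?_ ?_
    · rintro s t ⟨R, U, hU, h⟩ ⟨R', U', hU', h'⟩
      refine ⟨max R R', U ∩ U', inter_mem hU hU', fun q hq => ?_⟩
      rcases hq with hq | hq
      · obtain ⟨V, hV, hR⟩ := h q hq
        exact ⟨V, hV, fun x hx y hy => (hR x (Triples.near_mono inter_subset_left hx) y hy).trans
          (le_max_left _ _)⟩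
      · obtain ⟨V, hV, hR⟩ := h' q hq
        exact ⟨V, hV, fun x hx y hy => (hR x (Triples.near_mono inter_subset_right hx) y hy).trans
          (le_max_right _ _)⟩
    · intro q hq
      obtain ⟨R, U, hU, V, hV, h⟩ := exists_gromovProduct_le hconv hne A
        (q := φ ξ) (q' := q) (fun h => hq (h ▸ hξ)) p
      exact ⟨interior V, mem_nhdsWithin_of_mem_nhds (interior_mem_nhds.2 hV), R, U, hU,
        fun t ht => ⟨V, mem_interior_iff_mem_nhds.1 ht, h⟩⟩
  obtain ⟨R, U, hU, hR⟩ := hbound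
  -- The extra 1 gives a strict inequality, needed to extract representatives from the supremum.
  refine ⟨R + 1, fun η hη => ?_⟩
  by_contra hηW
  obtain ⟨y, rfl, x, rfl, h⟩ := exists_lt_gromovProduct_of_lt_boundaryProduct
    (lt_of_lt_of_le (EReal.coe_lt_coe_iff.2 (lt_add_one R)) hη)
  obtain ⟨V, hV, hUV⟩ := hR _ hηW
  obtain ⟨⟨m, n⟩, h1, h2, h3⟩ := (h.and
    ((tukiaTendsto_iff.1 (hφ y) V hV).prod_mk (tukiaTendsto_iff.1 (hφ x) U hU))).exists
  rw [gromovProduct_comm hconv] at h1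
  exact h1.not_ge (hUV _ h3 _ h2)

/-- Sequences of triples that converge to an infinite boundary point have large Gromov products. -/
lemma tendsto_gromovProduct (hconv : IsConvergenceAction G M) (hne : IsNonElementaryAction G M)
    {q : M} (hq : q ∈ A.infiniteBoundary G) {x y : ℕ → Triples M} (hx : TukiaTendsto x q)
    (hy : TukiaTendsto y q) (p : Triples M) :
    Tendsto (fun mn : ℕ × ℕ => gromovProduct (A.rho G) p (x mn.1) (y mn.2))
      (atTop ×ˢ atTop) atTop := by
  refine tendsto_atTop.2 fun R => ?_
  obtain ⟨U, hU, h⟩ := exists_nhds_le_gromovProduct hconv hne hq p R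
  filter_upwards [(tukiaTendsto_iff.1 hx U hU).prod_mk (tukiaTendsto_iff.1 hy U hU)] with mn hmn
    using h _ hmn.1 _ hmn.2

lemma mk_eq_mk_of_tukiaTendsto (hconv : IsConvergenceAction G M) (hne : IsNonElementaryAction G M)
    {q : M} (hq : q ∈ A.infiniteBoundary G)
    {x y : {x : ℕ → Triples M // IsGromovSequence (A.rho G) x}} (hx : TukiaTendsto x.1 q)
    (hy : TukiaTendsto y.1 q) : GromovBoundary.mk (A.rho G) x = GromovBoundary.mk (A.rho G) y := by
  have hrel : GromovRelated (A.rho G) x y := by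
    intro p
    have h := tendsto_gromovProduct hconv hne hq hx hy p
    have hdiag : Tendsto (fun n : ℕ => (n, n)) atTop (atTop ×ˢ atTop) :=
      tendsto_id.prodMk tendsto_id
    have h' := h.comp hdiag
    simp only [Function.comp_def] at h'
    exact h'
  exact Quot.sound hrel

/-- Representatives of both classes tend to the same infinite boundary point, so their mutual Gromov
products tend to infinity. -/
lemma limitMap_injOn (hconv : IsConvergenceAction G M) (hne : IsNonElementaryAction G M)
    (hφ : ∀ x, TukiaTendsto x.1 (φ (GromovBoundary.mk _ x))) {ξ η : GromovBoundary (A.rho G)}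
    (hξ : φ ξ ∈ A.infiniteBoundary G) (h : φ ξ = φ η) : ξ = η := by
  obtain ⟨x, hx⟩ : ∃ x, GromovBoundary.mk (A.rho G) x = ξ := Quot.exists_rep ξ
  obtain ⟨y, hy⟩ : ∃ y, GromovBoundary.mk (A.rho G) y = η := Quot.exists_rep η
  have hx' := hφ x
  have hy' := hφ y
  rw [hx] at hx'
  rw [hy, ← h] at hy'
  rw [← hx, ← hy]
  exact mk_eq_mk_of_tukiaTendsto hconv hne hξ hx' hy'

/-- At infinite boundary points, the topology of the Gromov boundary is induced by the limit map. -/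
lemma comap_nhds_le (hconv : IsConvergenceAction G M) (hne : IsNonElementaryAction G M)
    (hφ : ∀ x, TukiaTendsto x.1 (φ (GromovBoundary.mk _ x))) {ξ : GromovBoundary (A.rho G)}
    (hξ : φ ξ ∈ A.infiniteBoundary G) : comap φ (𝓝 (φ ξ)) ≤ 𝓝 ξ := by
  intro V hV
  obtain ⟨V', hVV', hV', hξV'⟩ := mem_nhds_iff.1 hV
  obtain ⟨p⟩ := nonempty_triples hne A
  obtain ⟨R, hR⟩ := hV' ξ hξV' p
  obtain ⟨U, hU, h⟩ := exists_nhds_le_gromovProduct hconv hne hξ p R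
  -- With φ η in the interior, U is a neighbourhood of φ η as well, so representatives of η and of ξ
  -- are both eventually near U.
  refine ⟨interior U, interior_mem_nhds.2 hU, fun η hη => hVV' (hR η ?_)⟩
  obtain ⟨x, rfl⟩ := Quot.exists_rep ξ
  obtain ⟨y, rfl⟩ := Quot.exists_rep η
  refine le_trans (le_liminf_of_le (by isBoundedDefault) ?_) (le_iSup₂_of_le y rfl
    (le_iSup₂_of_le x rfl le_rfl))
  filter_upwards [(tukiaTendsto_iff.1 (hφ y) U (mem_interior_iff_mem_nhds.1 hη)).prod_mk
    (tukiaTendsto_iff.1 (hφ x) U hU)] with mn hmn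
  exact EReal.coe_le_coe_iff.2 (h _ hmn.1 _ hmn.2)

end Boundary

end Annulus

theorem mainTheorem3 {G M : Type*} [Group G] [Countable G] [TopologicalSpace M] [CompactSpace M]
    [TopologicalSpace.MetrizableSpace M] [MulAction G M] [ContinuousConstSMul G M]
    (hconv : IsConvergenceAction G M) (hne : IsNonElementaryAction G M)
    (hmin : MulAction.IsMinimal G M) (A : Annulus M) (hA : A.IsAdmissible G) :
    (∀ x y : Triples M, Annulus.tripleDist (A.system G) x y ≠ ⊤) ∧
    ∃ φ : GromovBoundary (A.rho G) → M,
      Continuous φ ∧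
      (∀ (g : G) (ξ : GromovBoundary (A.rho G)), φ (g • ξ) = g • φ ξ) ∧
      ∃ e : (φ ⁻¹' A.infiniteBoundary G) ≃ₜ (A.infiniteBoundary G),
        ∀ ξ : φ ⁻¹' A.infiniteBoundary G, ((e ξ : A.infiniteBoundary G) : M) = φ ξ := by
  obtain ⟨φ, hφ⟩ := Annulus.exists_limitMap hconv hne A
  have hcont := Annulus.continuous_limitMap hconv hne hφ
  refine ⟨Annulus.tripleDist_ne_top hconv A, φ, hcont, Annulus.limitMap_smul hconv hne hφ, ?_⟩
  have hinj : Function.Injective ((A.infiniteBoundary G).restrictPreimage φ) := fun ξ η h =>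
    Subtype.ext (Annulus.limitMap_injOn hconv hne hφ ξ.2 (congrArg Subtype.val h))
  have hsurj : Function.Surjective ((A.infiniteBoundary G).restrictPreimage φ) := by
    rintro ⟨q, hq⟩
    -- As q is not isolated, triples converge to it; as q is an infinite boundary point, they form a
    -- Gromov sequence.
    obtain ⟨x, hx⟩ := Annulus.exists_tukiaTendsto_of_neBot hne (Annulus.neBot_nhdsNE hne hmin hA q)
    have hxφ := Annulus.limitMap_eq hconv hne hφ
      ⟨x, Annulus.tendsto_gromovProduct hconv hne hq hx hx⟩ hx
    exact ⟨⟨_, show φ _ ∈ _ from hxφ.symm ▸ hq⟩, Subtype.ext hxφ⟩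
  have hind : IsInducing ((A.infiniteBoundary G).restrictPreimage φ) := by
    refine isInducing_iff_nhds.2 fun ξ => le_antisymm
      (hcont.restrictPreimage.tendsto ξ).le_comap ?_
    rw [nhds_subtype_eq_comap, nhds_subtype_eq_comap, comap_comap]
    have h := comap_mono (m := ((↑) : φ ⁻¹' A.infiniteBoundary G → _))
      (Annulus.comap_nhds_le hconv hne hφ ξ.2)
    rwa [comap_comap] at h
  exact ⟨IsEmbedding.toHomeomorphOfSurjective ⟨hind, hinj⟩ hsurj, fun ξ => rfl⟩
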